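/- **Setting.** Consider a Markov decision process $\mathcal M$ with finite state space $\mathcal S$, finite action space $\mathcal A$ (transmit powers), nonempty sets $\mathcal A_s\subseteq\mathcal A$ of allowed actions and known transition probabilities $P(s'\mid s,a)$. Assume that $\mathcal M$ is ergodic: every deterministic stationary policy $\beta$ (a map $s\mapsto\beta(s)\in\mathcal A_s$) leads to an irreducible and aperiodic Markov chain, whose stationary distribution is denoted $\pi_\beta$. There are $M$ channels. The gain of a channel with parameter $\theta\in\Psi$ has density $g(\cdot;\theta)$ with respect to a measure $\nu$ on a measurable space $\mathcal X$. In each slot $t$ the agent observes the state $s_t$, chooses an action $a_t\in\mathcal A_{s_t}$ and a channel $j_t$, observes the gain $X_t$, which given the past has density $g(\cdot;\theta_{j_t})$, and receives the reward $r_t=f(a_t,X_t)$, where $f$ is known; given the past and $X_t$, the next state has law $P(\cdot\mid s_t,a_t)$. The law of the initial state is arbitrary but fixed. An allocation rule chooses $(a_t,j_t)$, possibly at random, as a function of $s_t$ and of the states, actions, channels and observed gains in the earlier slots. Write $$\mu(a;\theta)=\int f(a,x)\,g(x;\theta)\,d\nu(x),\qquad I(\theta,\theta')=\int \ln\frac{g(x;\theta)}{g(x;\theta')}\,g(x;\theta)\,d\nu(x)\in[0,\infty].$$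 For a parameter vector $\boldsymbol\theta=(\theta_1,\dots,\theta_M)\in\Psi^M$ put $\mu^*(a)=\max_j\mu(a;\theta_j)$, $\rho(\beta)=\sum_{s}\pi_\beta(s)\,\mu^*(\beta(s))$ and $\rho^*=\max_\beta\rho(\beta)$. The regret of a rule $\mathcal L$ is $\mathfrak R_{\mathcal L}(T)=T\rho^*-\mathbb E_{\boldsymbol\theta}\big[\sum_{t=0}^{T-1}r_t\big]$. A channel $j$ is *optimal* under $\boldsymbol\theta$ if there are a policy $\beta$ with $\rho(\beta)=\rho^*$ and a state $s$ with $\pi_\beta(s)>0$ such that $\mu(\beta(s);\theta_j)=\mu^*(\beta(s))$. Let $\mathcal O_{\boldsymbol\theta}$ be the set of optimal channels, and let $N_i(T)$ be the number of plays of channel $i$ in the first $T$ slots. **Assumptions.** - A1: for all $\theta\in\Psi$ and $a\in\mathcal A$, the mean $\mu(a;\theta)$ exists and is finite. - A2: for all $\theta\in\Psi$, $a\in\mathcal A$ and $\delta>0$ there is $\theta'\in\Psi$ with $\mu(a;\theta)<\mu(a;\theta')<\mu(a;\theta)+\delta$. - A3: $0<I(\theta,\theta')<\infty$ whenever $\mu(a;\theta)<\mu(a;\theta')$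 for some $a\in\mathcal A$. - A4: for all $\varepsilon>0$, $a\in\mathcal A$ and $\theta,\theta'\in\Psi$ with $\mu(a;\theta)<\mu(a;\theta')$ there is $\delta>0$ such that $|I(\theta,\theta')-I(\theta,\theta'')|<\varepsilon$ whenever $\mu(a;\theta')<\mu(a;\theta'')<\mu(a;\theta')+\delta$. **Theorem.** Assume A1–A4. Let $\mathcal L$ be an allocation rule such that, for every parameter vector in $\Psi^M$ and every $b>0$, $\mathfrak R_{\mathcal L}(T)=o(T^b)$ as $T\to\infty$. Then for every parameter vector $\boldsymbol\theta\in\Psi^M$ the set $\mathcal O_{\boldsymbol\theta}$ is nonempty, and for every channel $i\notin\mathcal O_{\boldsymbol\theta}$, $$\liminf_{T\to\infty}\ \mathbb E_{\boldsymbol\theta}\!\left[\frac{N_i(T)}{\ln T}\right]\ \ge\ \max_{j\in\mathcal O_{\boldsymbol\theta}}\frac{1}{I(\theta_i,\theta_j)}.$$ -/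

import Mathlib

open MeasureTheory ProbabilityTheory Filter Asymptotics
open scoped ENNReal

namespace MultiChannel

noncomputable section

/-! ### The Markov decision process -/

/-- A Markov decision process with state space `S` and action space `A` (the transmit powers):
the nonempty set `allowed s` of actions available in state `s`, and the law `trans (s, a)` of the
next state. Finiteness of `S` and `A` is imposed where it is used. -/
structure MDP (S A : Type*) [MeasurableSpace S] [MeasurableSpace A] where
  allowed : S → Set A
  allowed_nonempty : ∀ s, (allowed s).Nonempty
  trans : Kernel (S × A) S
  isMarkovKernel_trans : IsMarkovKernel trans

attribute [instance] MDP.isMarkovKernel_trans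

namespace MDP

variable {S A : Type*} [MeasurableSpace S] [MeasurableSpace A]

/-- Deterministic stationary policies. -/
def Policy (D : MDP S A) : Type _ := ∀ s : S, {a : A // a ∈ D.allowed s}

/-- The transition matrix of the Markov chain of states under the policy `β`. -/
def transMatrix (D : MDP S A) (β : D.Policy) : Matrix S S ℝ :=
  Matrix.of fun s s' => (D.trans (s, (β s : A))).real {s'}

/-- Every deterministic stationary policy leads to an irreducible and aperiodic Markov chain. -/
def IsErgodic [Fintype S] [DecidableEq S] (D : MDP S A) : Prop :=
  ∀ β : D.Policy,
    (∀ s s' : S, ∃ n : ℕ, 0 < (D.transMatrix β ^ n) s s') ∧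
    (∀ s : S, ∀ d : ℕ, (∀ n : ℕ, 0 < n → 0 < (D.transMatrix β ^ n) s s → d ∣ n) → d = 1)

/-- `π` is a stationary distribution of the chain of states under `β`. -/
def IsStationary [Fintype S] (D : MDP S A) (β : D.Policy) (π : S → ℝ) : Prop :=
  π ∈ stdSimplex ℝ S ∧ Matrix.vecMul π (D.transMatrix β) = π

open Classical in
/-- The stationary distribution `π_β` (it exists and is unique when the process is ergodic). -/
def stationaryDist [Fintype S] (D : MDP S A) (β : D.Policy) : S → ℝ :=
  if h : ∃ π, D.IsStationary β π then h.choose else 0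

end MDP

/-! ### The channel gains and the rates -/

/-- A family of densities `g (·; θ)`, `θ ∈ Ψ`, of a channel gain with respect to a measure `ν` on
the space `𝒳` of gains, and the rate `f a x` obtained with transmit power `a` and gain `x`. -/
structure GainModel (Ψ A 𝒳 : Type*) [MeasurableSpace 𝒳] where
  ν : Measure 𝒳
  g : Ψ → 𝒳 → ℝ
  measurable_g : ∀ θ, Measurable (g θ)
  g_nonneg : ∀ θ x, 0 ≤ g θ x
  lintegral_g : ∀ θ, ∫⁻ x, ENNReal.ofReal (g θ x) ∂ν = 1
  f : A → 𝒳 → ℝ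
  measurable_f : ∀ a, Measurable (f a)

namespace GainModel

variable {Ψ A 𝒳 : Type*} [MeasurableSpace 𝒳]

/-- The law of the gain with parameter `θ`. -/
def law (G : GainModel Ψ A 𝒳) (θ : Ψ) : Measure 𝒳 :=
  G.ν.withDensity fun x => ENNReal.ofReal (G.g θ x)

instance (G : GainModel Ψ A 𝒳) (θ : Ψ) : IsProbabilityMeasure (G.law θ) :=
  ⟨by rw [law, withDensity_apply _ MeasurableSet.univ, Measure.restrict_univ, G.lintegral_g]⟩

/-- The expected rate `μ(a; θ)`. -/
def mean (G : GainModel Ψ A 𝒳) (a : A) (θ : Ψ) : ℝ := ∫ x, G.f a x * G.g θ x ∂G.ν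

/-- The Kullback-Leibler distance `I(θ, θ') ∈ [0, ∞]`. -/
def I (G : GainModel Ψ A 𝒳) (θ θ' : Ψ) : ℝ≥0∞ := InformationTheory.klDiv (G.law θ) (G.law θ')

/-- A1: the means exist and are finite. -/
def A1 (G : GainModel Ψ A 𝒳) : Prop :=
  ∀ (θ : Ψ) (a : A), Integrable (fun x => G.f a x * G.g θ x) G.ν

/-- A2: denseness of the parameter set. -/
def A2 (G : GainModel Ψ A 𝒳) : Prop :=
  ∀ (θ : Ψ) (a : A) (δ : ℝ), 0 < δ → ∃ θ' : Ψ, G.mean a θ < G.mean a θ' ∧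
    G.mean a θ' < G.mean a θ + δ

/-- A3: positivity and finiteness of the distance. -/
def A3 (G : GainModel Ψ A 𝒳) : Prop :=
  ∀ θ θ' : Ψ, (∃ a : A, G.mean a θ < G.mean a θ') → 0 < G.I θ θ' ∧ G.I θ θ' < ∞

/-- A4: continuity of the distance in its second argument. -/
def A4 (G : GainModel Ψ A 𝒳) : Prop :=
  ∀ (ε : ℝ), 0 < ε → ∀ (a : A) (θ θ' : Ψ), G.mean a θ < G.mean a θ' →
    ∃ δ : ℝ, 0 < δ ∧ ∀ θ'' : Ψ, G.mean a θ' < G.mean a θ'' → G.mean a θ'' < G.mean a θ' + δ →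
      |(G.I θ θ').toReal - (G.I θ θ'').toReal| < ε

end GainModel

/-! ### The genie's benchmark and the optimal channels -/

section Optimal

variable {S A Ψ 𝒳 : Type*} [Fintype S] [MeasurableSpace S] [MeasurableSpace A]
  [MeasurableSpace 𝒳] {M : ℕ}

/-- The best expected rate `μ^*(a) = max_j μ(a; θ_j)` of the power level `a`. -/
def bestMean (G : GainModel Ψ A 𝒳) (θ : Fin M → Ψ) (a : A) : ℝ := ⨆ j : Fin M, G.mean a (θ j)

/-- The average reward of `β` when each power level is used on a best channel for it. -/
def avgReward (D : MDP S A) (G : GainModel Ψ A 𝒳) (θ : Fin M → Ψ) (β : D.Policy) : ℝ :=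
  ∑ s, D.stationaryDist β s * bestMean G θ (β s)

/-- The average reward `ρ^*` of the genie. -/
def optReward (D : MDP S A) (G : GainModel Ψ A 𝒳) (θ : Fin M → Ψ) : ℝ :=
  ⨆ β : D.Policy, avgReward D G θ β

/-- The set of optimal channels: those that are best for a power level which some optimal policy
uses with positive stationary probability. -/
def optimalChannels (D : MDP S A) (G : GainModel Ψ A 𝒳) (θ : Fin M → Ψ) : Set (Fin M) :=
  {j | ∃ β : D.Policy, (∀ β' : D.Policy, avgReward D G θ β' ≤ avgReward D G θ β) ∧
    ∃ s : S, 0 < D.stationaryDist β s ∧ ∀ k : Fin M, G.mean (β s) (θ k) ≤ G.mean (β s) (θ j)}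

end Optimal

/-! ### Allocation rules and the law of the controlled process -/

/-- The record of one slot: the state, the chosen power level and channel, and the gain of the
chosen channel, which is observed. -/
abbrev Slot (S A 𝒳 : Type*) (M : ℕ) : Type _ := S × ((A × Fin M) × 𝒳)

/-- An allocation rule. In slot `n` it sees the records of the slots `0, …, n - 1` and the current
state, and chooses, possibly at random, an allowed power level and a channel. -/
structure AllocationRule {S A : Type*} [MeasurableSpace S] [MeasurableSpace A]
    (D : MDP S A) (𝒳 : Type*) [MeasurableSpace 𝒳] (M : ℕ) where
  choose : (n : ℕ) → Kernel ((Fin n → Slot S A 𝒳 M) × S) (A × Fin M)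
  isMarkovKernel_choose : ∀ n, IsMarkovKernel (choose n)
  choose_allowed : ∀ n h s, choose n (h, s) {p | p.1 ∉ D.allowed s} = 0

attribute [instance] AllocationRule.isMarkovKernel_choose

section Dynamics

variable {S A Ψ 𝒳 : Type*} [MeasurableSpace S] [MeasurableSpace A] [MeasurableSpace 𝒳] {M : ℕ}

/-- The law of the gain of the chosen channel. -/
def gainKernel (G : GainModel Ψ A 𝒳) (θ : Fin M → Ψ) : Kernel (Fin M) 𝒳 where
  toFun j := G.law (θ j)
  measurable' := measurable_of_countable _

instance (G : GainModel Ψ A 𝒳) (θ : Fin M → Ψ) : IsMarkovKernel (gainKernel G θ) :=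
  ⟨fun j => inferInstanceAs (IsProbabilityMeasure (G.law (θ j)))⟩

/-- Given the past and the current state, the joint law of the choice of the rule and the gain. -/
def respond {D : MDP S A} (L : AllocationRule D 𝒳 M) (G : GainModel Ψ A 𝒳) (θ : Fin M → Ψ)
    (n : ℕ) : Kernel ((Fin n → Slot S A 𝒳 M) × S) ((A × Fin M) × 𝒳) :=
  L.choose n ⊗ₖ (gainKernel G θ).comap (fun p => p.2.2) (by fun_prop)

instance {D : MDP S A} (L : AllocationRule D 𝒳 M) (G : GainModel Ψ A 𝒳) (θ : Fin M → Ψ)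
    (n : ℕ) : IsMarkovKernel (respond L G θ n) := by
  unfold respond; infer_instance

/-- The law of the record of slot `0`, when the initial state has law `init`. -/
def firstSlot {D : MDP S A} (L : AllocationRule D 𝒳 M) (G : GainModel Ψ A 𝒳) (θ : Fin M → Ψ)
    (init : Measure S) : Measure (Slot S A 𝒳 M) :=
  init ⊗ₘ (respond L G θ 0).comap (fun s => (Fin.elim0, s)) (by fun_prop)

instance {D : MDP S A} (L : AllocationRule D 𝒳 M) (G : GainModel Ψ A 𝒳) (θ : Fin M → Ψ)
    (init : Measure S) [IsProbabilityMeasure init] :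
    IsProbabilityMeasure (firstSlot L G θ init) := by
  unfold firstSlot; infer_instance

/-- The law of the record of slot `n + 1`, given the records of the slots `0, …, n`. -/
def nextSlot {D : MDP S A} (L : AllocationRule D 𝒳 M) (G : GainModel Ψ A 𝒳) (θ : Fin M → Ψ)
    (n : ℕ) : Kernel (Finset.Iic n → Slot S A 𝒳 M) (Slot S A 𝒳 M) :=
  D.trans.comap
      (fun h => ((h ⟨n, Finset.mem_Iic.2 le_rfl⟩).1, (h ⟨n, Finset.mem_Iic.2 le_rfl⟩).2.1.1))
      (by fun_prop) ⊗ₖ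
    (respond L G θ (n + 1)).comap
      (fun p => (fun k : Fin (n + 1) => p.1 ⟨k, Finset.mem_Iic.2 (Nat.lt_succ_iff.1 k.2)⟩, p.2))
      (by fun_prop)

instance {D : MDP S A} (L : AllocationRule D 𝒳 M) (G : GainModel Ψ A 𝒳) (θ : Fin M → Ψ)
    (n : ℕ) : IsMarkovKernel (nextSlot L G θ n) := by
  unfold nextSlot; infer_instance

/-- The probability measure `P_θ` on infinite sequences of records. -/
def trajLaw {D : MDP S A} (L : AllocationRule D 𝒳 M) (G : GainModel Ψ A 𝒳) (θ : Fin M → Ψ)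
    (init : Measure S) [IsProbabilityMeasure init] : Measure (ℕ → Slot S A 𝒳 M) :=
  Kernel.trajMeasure (X := fun _ => Slot S A 𝒳 M) (firstSlot L G θ init)
    (fun n => nextSlot L G θ n)

/-- The reward `r_t = f(a_t, X_t)`. -/
def reward (G : GainModel Ψ A 𝒳) (t : ℕ) (ω : ℕ → Slot S A 𝒳 M) : ℝ :=
  G.f (ω t).2.1.1 (ω t).2.2

/-- The regret `T ρ^* - E_θ[∑_{t < T} r_t]`. -/
def regret [Fintype S] {D : MDP S A} (L : AllocationRule D 𝒳 M) (G : GainModel Ψ A 𝒳)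
    (θ : Fin M → Ψ) (init : Measure S) [IsProbabilityMeasure init] (T : ℕ) : ℝ :=
  T * optReward D G θ - ∫ ω, ∑ t ∈ Finset.range T, reward G t ω ∂(trajLaw L G θ init)

/-- The number `N_i(T)` of the slots `t < T` in which channel `i` is played. -/
def plays (i : Fin M) (T : ℕ) (ω : ℕ → Slot S A 𝒳 M) : ℕ :=
  ((Finset.range T).filter fun t => (ω t).2.1.2 = i).card

end Dynamics

end

end MultiChannel

/-!
Let `i` be a suboptimal channel, `j` an optimal one, and `θ'` the parameters obtained from `θ` by
moving `θ_i` slightly above `θ_j`. Under `θ'` no policy that avoids channel `i` earns `ρ^*(θ')`: the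
policy that was optimal under `θ` has improved, whereas the other channels have not. The Poisson
equation of an optimal policy provides a bias function `h` for which every choice has a nonnegative
gap `ρ^* + h(s) - (μ(a; θ_k) + E[h(s') | s, a])`, and the regret is, up to a bounded term, the
expected sum of these gaps. Comparing the bias functions of `θ` and `θ'`, a trajectory with few
plays of `i` has, up to a martingale of variance `O(T)`, a gap sum linear in `T` under `θ'`; small
regret therefore makes `{N_i(T) < ηT}` an event of probability `O(T^(b-1))` under `θ'`.

The laws of the first `T` records under `θ` and `θ'` have relative entropy at most
`I(θ_i, θ'_i) E_θ[N_i(T)]`. By the Donsker–Varadhan inequality with the test function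
`(1 - b) ln T · 1{N_i(T) < ηT}`, the event can have probability close to one under `θ` only if
`I(θ_i, θ'_i) E_θ[N_i(T)] ≥ (1 - b) ln T - O(1)`; otherwise Markov's inequality already makes
`E_θ[N_i(T)]` linear in `T`. Finally `b → 0`, and `I(θ_i, θ'_i) → I(θ_i, θ_j)` by A4.
-/

namespace MultiChannel

noncomputable section

/-! ### Finite stochastic matrices -/

section StochasticMatrix

open Matrix

variable {S : Type*} [Fintype S] [DecidableEq S] {P : Matrix S S ℝ}

lemma pow_mulVec_eq_self {h : S → ℝ} (hh : P *ᵥ h = h) (n : ℕ) : P ^ n *ᵥ h = h := by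
  induction n with
  | zero => simp
  | succ n ih => rw [pow_succ, ← mulVec_mulVec, hh, ih]

lemma vecMul_pow_eq_self {π : S → ℝ} (hπ : π ᵥ* P = π) (n : ℕ) : π ᵥ* P ^ n = π := by
  induction n with
  | zero => simp
  | succ n ih => rw [pow_succ, ← vecMul_vecMul, ih, hπ]

lemma eq_of_mulVec_eq_self (hP : P ∈ rowStochastic ℝ S)
    (hirr : ∀ s s' : S, ∃ n : ℕ, 0 < (P ^ n) s s') {h : S → ℝ} (hh : P *ᵥ h = h) (s s' : S) :
    h s = h s' := by
  have : Nonempty S := ⟨s⟩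
  obtain ⟨m, hm⟩ := Finite.exists_max h
  suffices heq : ∀ y, h y = h m by rw [heq s, heq s']
  intro y
  obtain ⟨n, hn⟩ := hirr m y
  have hPn := pow_mem hP n
  have hfix : ∑ x, (P ^ n) m x * h x = h m := congrFun (pow_mulVec_eq_self hh n) m
  -- `h m` is an average of values of `h`, none of which exceeds it.
  have hsum : ∑ x, (P ^ n) m x * (h m - h x) = 0 := by
    simp only [mul_sub, Finset.sum_sub_distrib, ← Finset.sum_mul,
      sum_row_of_mem_rowStochastic hPn, hfix, one_mul, sub_self]
  have hterm := (Finset.sum_eq_zero_iff_of_nonneg fun x _ => mul_nonneg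
    (nonneg_of_mem_rowStochastic hPn) (sub_nonneg.2 (hm x))).1 hsum y (Finset.mem_univ y)
  linarith [(mul_eq_zero.1 hterm).resolve_left hn.ne']

lemma exists_vecMul_eq_self_of_mem_rowStochastic [Nonempty S] (hP : P ∈ rowStochastic ℝ S) :
    ∃ v : S → ℝ, v ≠ 0 ∧ v ᵥ* P = v := by
  have hdet : (1 - P).det = 0 := exists_mulVec_eq_zero_iff.1
    ⟨1, one_ne_zero, by rw [sub_mulVec, one_vecMul_of_mem_rowStochastic hP, one_mulVec, sub_self]⟩
  obtain ⟨v, hv0, hv⟩ := exists_vecMul_eq_zero_iff.2 hdet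
  rw [vecMul_sub, vecMul_one, sub_eq_zero] at hv
  exact ⟨v, hv0, hv.symm⟩

lemma abs_vecMul_eq_abs (hP : P ∈ rowStochastic ℝ S) {v : S → ℝ} (hv : v ᵥ* P = v) :
    |v| ᵥ* P = |v| := by
  have hle : ∀ y, |v| y ≤ (|v| ᵥ* P) y := fun y =>
    calc |v y| = |∑ x, v x * P x y| := congrArg abs (congrFun hv y).symm
      _ ≤ ∑ x, |v x * P x y| := Finset.abs_sum_le_sum_abs _ _
      _ = ∑ x, |v x| * P x y := Finset.sum_congr rfl fun x _ => by
        rw [abs_mul, abs_of_nonneg (nonneg_of_mem_rowStochastic hP)]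
  have hsum : ∑ y, |v| y = ∑ y, (|v| ᵥ* P) y := by
    simp only [vecMul, dotProduct]
    rw [Finset.sum_comm]
    simp only [← Finset.mul_sum, sum_row_of_mem_rowStochastic hP, mul_one]
  funext y
  exact ((Finset.sum_eq_sum_iff_of_le fun y _ => hle y).1 hsum y (Finset.mem_univ y)).symm

lemma exists_stationary_mem_stdSimplex [Nonempty S] (hP : P ∈ rowStochastic ℝ S) :
    ∃ π ∈ stdSimplex ℝ S, π ᵥ* P = π := by
  obtain ⟨v, hv0, hv⟩ := exists_vecMul_eq_self_of_mem_rowStochastic hP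
  have hpos : 0 < ∑ y, |v| y := by
    obtain ⟨y, hy⟩ := Function.ne_iff.1 hv0
    exact Finset.sum_pos' (fun y _ => abs_nonneg _) ⟨y, Finset.mem_univ y, abs_pos.2 hy⟩
  refine ⟨(∑ y, |v| y)⁻¹ • |v|,
    ⟨fun y => mul_nonneg (inv_nonneg.2 hpos.le) (abs_nonneg _), ?_⟩, ?_⟩
  · simp only [Pi.smul_apply, smul_eq_mul, ← Finset.mul_sum, inv_mul_cancel₀ hpos.ne']
  · rw [smul_vecMul, abs_vecMul_eq_abs hP hv]

lemma stationary_pos (hP : P ∈ rowStochastic ℝ S)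
    (hirr : ∀ s s' : S, ∃ n : ℕ, 0 < (P ^ n) s s') {π : S → ℝ} (hπ : π ∈ stdSimplex ℝ S)
    (hst : π ᵥ* P = π) (s : S) : 0 < π s := by
  obtain ⟨s₀, -, hs₀⟩ := Finset.exists_ne_zero_of_sum_ne_zero (hπ.2.trans_ne one_ne_zero)
  obtain ⟨n, hn⟩ := hirr s₀ s
  calc 0 < ∑ x, π x * (P ^ n) x s := Finset.sum_pos'
        (fun x _ => mul_nonneg (hπ.1 x) (nonneg_of_mem_rowStochastic (pow_mem hP n)))
        ⟨s₀, Finset.mem_univ _, mul_pos ((hπ.1 s₀).lt_of_ne' hs₀) hn⟩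
    _ = π s := congrFun (vecMul_pow_eq_self hst n) s

/-- The fundamental matrix of a stochastic matrix `P` with stationary distribution `π`, whose
inverse solves the Poisson equation: it maps `h` to `h - P h + π(h)`. -/
def poissonMatrix (P : Matrix S S ℝ) (π : S → ℝ) : Matrix S S ℝ := 1 - P + vecMulVec 1 π

lemma poissonMatrix_mulVec (P : Matrix S S ℝ) (π h : S → ℝ) :
    poissonMatrix P π *ᵥ h = h - P *ᵥ h + fun _ => π ⬝ᵥ h := by
  rw [poissonMatrix, add_mulVec, sub_mulVec, one_mulVec, vecMulVec_mulVec]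
  congr 1
  funext s
  simp

lemma dotProduct_poissonMatrix_mulVec {π : S → ℝ} (hπ : π ∈ stdSimplex ℝ S) (hst : π ᵥ* P = π)
    (h : S → ℝ) : π ⬝ᵥ (poissonMatrix P π *ᵥ h) = π ⬝ᵥ h := by
  have hconst : (π ⬝ᵥ fun _ => π ⬝ᵥ h) = π ⬝ᵥ h := by
    simp only [dotProduct, ← Finset.sum_mul, hπ.2, one_mul]
  rw [poissonMatrix_mulVec, dotProduct_add, dotProduct_sub, dotProduct_mulVec, hst, sub_self,
    zero_add, hconst]

lemma poissonMatrix_mulVec_injective (hP : P ∈ rowStochastic ℝ S)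
    (hirr : ∀ s s' : S, ∃ n : ℕ, 0 < (P ^ n) s s') {π : S → ℝ} (hπ : π ∈ stdSimplex ℝ S)
    (hst : π ᵥ* P = π) : Function.Injective (poissonMatrix P π *ᵥ ·) := by
  refine (injective_iff_map_eq_zero (poissonMatrix P π).mulVecLin).2 fun h hh => ?_
  rw [mulVecLin_apply] at hh
  have hπh : π ⬝ᵥ h = 0 := by rw [← dotProduct_poissonMatrix_mulVec hπ hst, hh, dotProduct_zero]
  have hfix : P *ᵥ h = h := by
    rw [poissonMatrix_mulVec, hπh] at hh
    funext s
    linarith [show h s - (P *ᵥ h) s + 0 = 0 from congrFun hh s]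
  funext s
  calc h s = ∑ x, π x * h s := by rw [← Finset.sum_mul, hπ.2, one_mul]
    _ = π ⬝ᵥ h := Finset.sum_congr rfl fun x _ => by rw [eq_of_mulVec_eq_self hP hirr hfix s x]
    _ = 0 := hπh

lemma exists_poisson_solution (hP : P ∈ rowStochastic ℝ S)
    (hirr : ∀ s s' : S, ∃ n : ℕ, 0 < (P ^ n) s s') {π : S → ℝ} (hπ : π ∈ stdSimplex ℝ S)
    (hst : π ᵥ* P = π) (r : S → ℝ) : ∃ h : S → ℝ, ∀ s, r s + (P *ᵥ h) s = π ⬝ᵥ r + h s := by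
  obtain ⟨h, rfl⟩ := mulVec_surjective_iff_isUnit.2
    (mulVec_injective_iff_isUnit.1 (poissonMatrix_mulVec_injective hP hirr hπ hst)) r
  refine ⟨h, fun s => ?_⟩
  rw [dotProduct_poissonMatrix_mulVec hπ hst, poissonMatrix_mulVec]
  simp only [Pi.add_apply, Pi.sub_apply]
  ring

end StochasticMatrix

/-! ### The average-reward optimality inequality -/

namespace MDP

open Matrix

variable {S A : Type*} [MeasurableSpace S] [MeasurableSpace A]

/-- The expectation of `h` at the next state when action `a` is taken in state `s`. -/
def expNext (D : MDP S A) (h : S → ℝ) (s : S) (a : A) : ℝ := ∫ x, h x ∂(D.trans (s, a))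

instance (D : MDP S A) : Nonempty D.Policy :=
  ⟨fun s => ⟨(D.allowed_nonempty s).some, (D.allowed_nonempty s).some_mem⟩⟩

instance [Finite S] [Finite A] (D : MDP S A) : Finite D.Policy := by
  unfold Policy
  infer_instance

variable [Fintype S]

/-- The long-run average `∑ s, π_β(s) r(s, β(s))` of a one-step reward `r` under the policy
`β`. -/
def longRunReward (D : MDP S A) (r : S → A → ℝ) (β : D.Policy) : ℝ :=
  D.stationaryDist β ⬝ᵥ fun s => r s (β s)

/-- Every deterministic stationary policy leads to an irreducible Markov chain. -/
def IsIrreducible [DecidableEq S] (D : MDP S A) : Prop :=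
  ∀ (β : D.Policy) (s s' : S), ∃ n : ℕ, 0 < (D.transMatrix β ^ n) s s'

variable [MeasurableSingletonClass S]

lemma expNext_policy (D : MDP S A) (β : D.Policy) (h : S → ℝ) (s : S) :
    D.expNext h s (β s) = (D.transMatrix β *ᵥ h) s := by
  rw [expNext, integral_fintype .of_finite]
  rfl

lemma transMatrix_mem_rowStochastic [DecidableEq S] (D : MDP S A) (β : D.Policy) :
    D.transMatrix β ∈ rowStochastic ℝ S := by
  refine mem_rowStochastic.2 ⟨fun s s' => measureReal_nonneg, funext fun s => ?_⟩
  rw [← expNext_policy]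
  simp [expNext]

lemma isStationary_stationaryDist [Nonempty S] (D : MDP S A) (β : D.Policy) :
    D.IsStationary β (D.stationaryDist β) := by
  classical
  have h : ∃ π, D.IsStationary β π :=
    exists_stationary_mem_stdSimplex (D.transMatrix_mem_rowStochastic β)
  rw [stationaryDist, dif_pos h]
  exact h.choose_spec

lemma stationaryDist_dotProduct_expNext [Nonempty S] (D : MDP S A) (β : D.Policy) (h : S → ℝ) :
    (D.stationaryDist β ⬝ᵥ fun s => D.expNext h s (β s)) = D.stationaryDist β ⬝ᵥ h := by
  simp only [expNext_policy]
  rw [dotProduct_mulVec, (D.isStationary_stationaryDist β).2]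

variable [DecidableEq S] [Nonempty S] {D : MDP S A}

lemma stationaryDist_pos (hD : D.IsIrreducible) (β : D.Policy) (s : S) :
    0 < D.stationaryDist β s :=
  stationary_pos (D.transMatrix_mem_rowStochastic β) (hD β) (D.isStationary_stationaryDist β).1
    (D.isStationary_stationaryDist β).2 s

lemma lt_longRunReward (hD : D.IsIrreducible) {r : S → A → ℝ} {β : D.Policy} {ρ : ℝ} {h : S → ℝ}
    (hle : ∀ s, ρ + h s ≤ r s (β s) + D.expNext h s (β s)) {s₀ : S}
    (hlt : ρ + h s₀ < r s₀ (β s₀) + D.expNext h s₀ (β s₀)) : ρ < D.longRunReward r β := by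
  have hst := D.isStationary_stationaryDist β
  have hsum : ∑ s, D.stationaryDist β s * (ρ + h s) <
      ∑ s, D.stationaryDist β s * (r s (β s) + D.expNext h s (β s)) :=
    Finset.sum_lt_sum (fun s _ => mul_le_mul_of_nonneg_left (hle s) (hst.1.1 s))
      ⟨s₀, Finset.mem_univ s₀, mul_lt_mul_of_pos_left hlt (stationaryDist_pos hD β s₀)⟩
  have hdot : ∑ s, D.stationaryDist β s * D.expNext h s (β s) = ∑ s, D.stationaryDist β s * h s :=
    D.stationaryDist_dotProduct_expNext β h
  simp only [mul_add, Finset.sum_add_distrib, ← Finset.sum_mul, hst.1.2, one_mul, hdot] at hsum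
  exact lt_of_add_lt_add_right hsum

lemma exists_bias (hD : D.IsIrreducible) {r : S → A → ℝ} {β : D.Policy}
    (hβ : ∀ β' : D.Policy, D.longRunReward r β' ≤ D.longRunReward r β) :
    ∃ h : S → ℝ, ∀ s, ∀ a ∈ D.allowed s,
      r s a + D.expNext h s a ≤ D.longRunReward r β + h s := by
  have hst := D.isStationary_stationaryDist β
  obtain ⟨h, hh⟩ := exists_poisson_solution (D.transMatrix_mem_rowStochastic β) (hD β) hst.1 hst.2
    fun s => r s (β s)
  refine ⟨h, fun s a ha => le_of_not_gt fun hlt => ?_⟩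
  -- Otherwise switching to `a` in state `s` improves the policy.
  let β' : D.Policy := Function.update β s ⟨a, ha⟩
  have hβ's : (β' s : A) = a := congrArg Subtype.val (Function.update_self s _ β)
  have hβ' : ∀ x, x ≠ s → β' x = β x := fun x hx => Function.update_of_ne hx _ β
  refine (hβ β').not_gt (lt_longRunReward hD (h := h) (s₀ := s) (fun x => ?_) (hβ's.symm ▸ hlt))
  obtain rfl | hx := eq_or_ne x s
  · exact hβ's.symm ▸ hlt.le
  · rw [hβ' x hx, expNext_policy, hh x]
    rfl

end MDP

/-! ### Relative entropy -/

section RelativeEntropy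

open InformationTheory

variable {X Y J : Type*} [MeasurableSpace X] [MeasurableSpace Y]

lemma klDiv_compProd_withDensity (μ : Measure X) [IsFiniteMeasure μ] (η : Kernel X Y)
    [IsFiniteKernel η] {r : X → Y → ℝ≥0∞} (hr : Measurable (Function.uncurry r))
    [IsFiniteKernel (η.withDensity r)] :
    klDiv (μ ⊗ₘ η.withDensity r) (μ ⊗ₘ η) = ∫⁻ x, klDiv (η.withDensity r x) (η x) ∂μ := by
  have hmeas : Measurable fun p : X × Y => ENNReal.ofReal (klFun (r p.1 p.2).toReal) :=
    (measurable_klFun.comp hr.ennreal_toReal).ennreal_ofReal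
  have hsection : ∀ x, klDiv (η.withDensity r x) (η x) =
      ∫⁻ y, ENNReal.ofReal (klFun (r x y).toReal) ∂(η x) := by
    intro x
    rw [klDiv_eq_lintegral_klFun_of_ac (Kernel.withDensity_absolutelyContinuous r x),
      Kernel.withDensity_apply η hr]
    refine lintegral_congr_ae ?_
    filter_upwards [Measure.rnDeriv_withDensity (η x) hr.of_uncurry_left] with y hy
    rw [hy]
  have : IsFiniteMeasure ((μ ⊗ₘ η).withDensity fun p => r p.1 p.2) := by
    rw [← Measure.compProd_withDensity hr]
    infer_instance
  rw [Measure.compProd_withDensity hr,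
    klDiv_eq_lintegral_klFun_of_ac (withDensity_absolutelyContinuous _ _)]
  calc ∫⁻ p, ENNReal.ofReal (klFun (((μ ⊗ₘ η).withDensity fun p => r p.1 p.2).rnDeriv
        (μ ⊗ₘ η) p).toReal) ∂(μ ⊗ₘ η)
      = ∫⁻ p, ENNReal.ofReal (klFun (r p.1 p.2).toReal) ∂(μ ⊗ₘ η) := by
        refine lintegral_congr_ae ?_
        filter_upwards [Measure.rnDeriv_withDensity (μ ⊗ₘ η) hr] with p hp
        rw [← Function.uncurry_def, hp, Function.uncurry_def]
    _ = ∫⁻ x, klDiv (η.withDensity r x) (η x) ∂μ := by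
        rw [Measure.lintegral_compProd hmeas]
        exact lintegral_congr fun x => (hsection x).symm

lemma klDiv_compProd_comap [Countable J] [MeasurableSpace J] [DiscreteMeasurableSpace J]
    (μ : Measure X) [IsFiniteMeasure μ] {κ η : Kernel J Y} [IsFiniteKernel κ] [IsFiniteKernel η]
    (hac : ∀ j, κ j ≪ η j) {f : X → J} (hf : Measurable f) :
    klDiv (μ ⊗ₘ κ.comap f hf) (μ ⊗ₘ η.comap f hf) = ∫⁻ x, klDiv (κ (f x)) (η (f x)) ∂μ := by
  let r : X → Y → ℝ≥0∞ := fun x => (κ (f x)).rnDeriv (η (f x))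
  have hr : Measurable (Function.uncurry r) :=
    (measurable_from_prod_countable_right (f := fun p : J × Y => (κ p.1).rnDeriv (η p.1) p.2)
      fun j => Measure.measurable_rnDeriv (κ j) (η j)).comp (hf.prodMap measurable_id)
  have hκ : (η.comap f hf).withDensity r = κ.comap f hf := by
    ext x : 1
    rw [Kernel.withDensity_apply _ hr, Kernel.comap_apply, Kernel.comap_apply,
      Measure.withDensity_rnDeriv_eq _ _ (hac (f x))]
  have : IsFiniteKernel ((η.comap f hf).withDensity r) := hκ ▸ inferInstance
  rw [← hκ, klDiv_compProd_withDensity μ (η.comap f hf) hr, hκ]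
  rfl

lemma integral_le_klDiv_add_log_integral_exp {μ ν : Measure X} [IsProbabilityMeasure μ]
    [IsProbabilityMeasure ν] (hkl : klDiv μ ν ≠ ∞) {φ : X → ℝ} (hμ : Integrable φ μ)
    (hν : Integrable (fun x => Real.exp (φ x)) ν) :
    ∫ x, φ x ∂μ ≤ (klDiv μ ν).toReal + Real.log (∫ x, Real.exp (φ x) ∂ν) := by
  obtain ⟨hac, hint⟩ := klDiv_ne_top_iff.1 hkl
  have := isProbabilityMeasure_tilted hν
  -- The inequality says that the divergence of `μ` from the tilted measure is nonnegative.
  have hnonneg := integral_llr_add_sub_measure_univ_nonneg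
    (hac.trans (absolutelyContinuous_tilted hν)) (integrable_llr_tilted_right hac hμ hint hν)
  rw [integral_llr_tilted_right hac hμ hν hint, probReal_univ, probReal_univ] at hnonneg
  rw [toReal_klDiv_of_measure_eq hac (by rw [measure_univ, measure_univ])]
  linarith

lemma mul_measureReal_le_klDiv_add_log {μ ν : Measure X} [IsProbabilityMeasure μ]
    [IsProbabilityMeasure ν] (hkl : klDiv μ ν ≠ ∞) {E : Set X} (hE : MeasurableSet E) {c : ℝ} :
    c * μ.real E ≤ (klDiv μ ν).toReal + Real.log (1 + Real.exp c * ν.real E) := by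
  have hexp : (fun x => Real.exp (E.indicator (fun _ => c) x)) =
      fun x => 1 + E.indicator (fun _ => Real.exp c - 1) x := by
    funext x
    by_cases hx : x ∈ E <;> simp [hx]
  have hint : Integrable (E.indicator fun _ => Real.exp c - 1) ν :=
    (integrable_const _).indicator hE
  have hν : Integrable (fun x => Real.exp (E.indicator (fun _ => c) x)) ν :=
    hexp ▸ (integrable_const _).add hint
  have hlog : ∫ x, Real.exp (E.indicator (fun _ => c) x) ∂ν ≤ 1 + Real.exp c * ν.real E := by
    rw [hexp, integral_add (integrable_const _) hint, integral_indicator_const _ hE,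
      integral_const, probReal_univ, smul_eq_mul, smul_eq_mul]
    linarith [measureReal_nonneg (μ := ν) (s := E)]
  calc c * μ.real E = ∫ x, E.indicator (fun _ => c) x ∂μ := by
        rw [integral_indicator_const _ hE, smul_eq_mul, mul_comm]
    _ ≤ (klDiv μ ν).toReal + Real.log (∫ x, Real.exp (E.indicator (fun _ => c) x) ∂ν) :=
        integral_le_klDiv_add_log_integral_exp hkl ((integrable_const c).indicator hE) hν
    _ ≤ (klDiv μ ν).toReal + Real.log (1 + Real.exp c * ν.real E) := by
        gcongr
        exact integral_exp_pos hν

end RelativeEntropy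

/-! ### The finite-horizon laws of the controlled process -/

section General

variable {X Y Z : Type*} [MeasurableSpace X] [MeasurableSpace Y] [MeasurableSpace Z]

lemma map_compProd_eq_map_compProd_comap (μ : Measure X) [SFinite μ] {f : X → Y}
    (hf : Measurable f) (κ : Kernel Y Z) [IsSFiniteKernel κ] :
    μ.map f ⊗ₘ κ = (μ ⊗ₘ κ.comap f hf).map (Prod.map f id) := by
  ext s hs
  rw [Measure.compProd_apply hs, Measure.map_apply (by fun_prop) hs,
    Measure.compProd_apply (hs.preimage (by fun_prop)),
    lintegral_map (Kernel.measurable_kernel_prodMk_left hs) hf]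
  rfl

lemma measurable_finSnoc {n : ℕ} {f : X → Fin n → Y} {g : X → Y} (hf : Measurable f)
    (hg : Measurable g) : Measurable fun x => Fin.snoc (α := fun _ => Y) (f x) (g x) := by
  refine measurable_pi_iff.2 fun k => ?_
  induction k using Fin.lastCases with
  | last => simpa only [Fin.snoc_last] using hg
  | cast k => simpa only [Fin.snoc_castSucc] using measurable_pi_iff.1 hf k

lemma memLp_comp_of_finite [Finite Y] [MeasurableSingletonClass Y] (μ : Measure X)
    [IsFiniteMeasure μ] {f : X → Y} (hf : Measurable f) (φ : Y → ℝ) (p : ℝ≥0∞) :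
    MemLp (fun x => φ (f x)) p μ := by
  have := Fintype.ofFinite Y
  exact (MemLp.of_discrete (f := φ) (μ := μ.map f)).comp_of_map hf.aemeasurable

lemma integrable_comp_of_finite [Finite Y] [MeasurableSingletonClass Y] (μ : Measure X)
    [IsFiniteMeasure μ] {f : X → Y} (hf : Measurable f) (φ : Y → ℝ) :
    Integrable (fun x => φ (f x)) μ :=
  memLp_one_iff_integrable.1 (memLp_comp_of_finite μ hf φ 1)

end General

section History

/-- The records of the slots before `n`. -/
def hist {S A 𝒳 : Type*} {M : ℕ} (n : ℕ) (ω : ℕ → Slot S A 𝒳 M) : Fin n → Slot S A 𝒳 M :=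
  fun k => ω k

lemma snoc_hist {S A 𝒳 : Type*} {M : ℕ} (n : ℕ) (ω : ℕ → Slot S A 𝒳 M) :
    Fin.snoc (α := fun _ => Slot S A 𝒳 M) (hist n ω) (ω n) = hist (n + 1) ω := by
  funext k
  induction k using Fin.lastCases <;> simp [hist]

variable {S A Ψ 𝒳 : Type*} [MeasurableSpace S] [MeasurableSpace A] [MeasurableSpace 𝒳] {M : ℕ}

@[fun_prop]
lemma measurable_hist (n : ℕ) :
    Measurable (hist n : (ℕ → Slot S A 𝒳 M) → (Fin n → Slot S A 𝒳 M)) := by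
  unfold hist
  fun_prop

/-- The law of the state of slot `n`, given the records of the earlier slots. -/
def stateKernel (D : MDP S A) (𝒳 : Type*) [MeasurableSpace 𝒳] (M : ℕ) (init : Measure S) :
    (n : ℕ) → Kernel (Fin n → Slot S A 𝒳 M) S
  | 0 => Kernel.const _ init
  | n + 1 => D.trans.comap (fun h => ((h (Fin.last n)).1, (h (Fin.last n)).2.1.1)) (by fun_prop)

instance (D : MDP S A) (init : Measure S) [IsProbabilityMeasure init] (n : ℕ) :
    IsMarkovKernel (stateKernel D 𝒳 M init n) := by
  cases n <;> unfold stateKernel <;> infer_instance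

variable {D : MDP S A} (L : AllocationRule D 𝒳 M) (G : GainModel Ψ A 𝒳) (θ : Fin M → Ψ)
  (init : Measure S) [IsProbabilityMeasure init]

instance : IsProbabilityMeasure (trajLaw L G θ init) := by
  unfold trajLaw
  infer_instance

/-- The law of the records of the slots before `n`. -/
def histLaw (n : ℕ) : Measure (Fin n → Slot S A 𝒳 M) := (trajLaw L G θ init).map (hist n)

instance (n : ℕ) : IsProbabilityMeasure (histLaw L G θ init n) :=
  Measure.isProbabilityMeasure_map (measurable_hist n).aemeasurable

lemma histLaw_zero :
    histLaw L G θ init 0 = Measure.dirac (Fin.elim0 : Fin 0 → Slot S A 𝒳 M) := by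
  have hconst : (hist 0 : (ℕ → Slot S A 𝒳 M) → _) = fun _ => Fin.elim0 :=
    funext fun ω => Subsingleton.elim _ _
  rw [histLaw, hconst, Measure.map_const, measure_univ, one_smul]

lemma map_zero_trajLaw : (trajLaw L G θ init).map (fun ω => ω 0) = firstSlot L G θ init := by
  have hcomp : (fun ω : ℕ → Slot S A 𝒳 M => ω 0) =
      (fun h : Finset.Iic 0 → Slot S A 𝒳 M => h ⟨0, Finset.mem_Iic.2 le_rfl⟩) ∘
        Preorder.frestrictLe 0 := rfl
  rw [hcomp, ← Measure.map_map (by fun_prop) (by fun_prop), trajLaw, Kernel.trajMeasure,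
    Measure.map_comp _ _ (by fun_prop), Kernel.traj_map_frestrictLe, Kernel.partialTraj_self,
    Measure.id_comp, Measure.map_map (by fun_prop) (by fun_prop)]
  exact Measure.map_id

lemma nextSlot_eq_comap_stateKernel (n : ℕ) :
    nextSlot L G θ n = (stateKernel D 𝒳 M init (n + 1) ⊗ₖ respond L G θ (n + 1)).comap
      (fun (h : Finset.Iic n → Slot S A 𝒳 M) (k : Fin (n + 1)) =>
        h ⟨k, Finset.mem_Iic.2 (Nat.lt_succ_iff.1 k.2)⟩) (by fun_prop) := by
  ext h s hs
  rw [nextSlot, Kernel.comap_apply (stateKernel D 𝒳 M init (n + 1) ⊗ₖ respond L G θ (n + 1)),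
    Kernel.compProd_apply hs, Kernel.compProd_apply hs]
  rfl

lemma map_hist_slot_zero :
    (trajLaw L G θ init).map (fun ω => (hist 0 ω, ω 0)) =
      histLaw L G θ init 0 ⊗ₘ (stateKernel D 𝒳 M init 0 ⊗ₖ respond L G θ 0) := by
  have hcomp : (fun ω : ℕ → Slot S A 𝒳 M => (hist 0 ω, ω 0)) =
      Prod.mk (Fin.elim0 : Fin 0 → Slot S A 𝒳 M) ∘ fun ω => ω 0 :=
    funext fun ω => Prod.ext (Subsingleton.elim _ _) rfl
  rw [histLaw_zero, hcomp, ← Measure.map_map (by fun_prop) (by fun_prop), map_zero_trajLaw]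
  ext s hs
  rw [Measure.dirac_compProd_apply hs, Measure.map_apply (by fun_prop) hs,
    Kernel.compProd_apply_eq_compProd_sectR]
  rfl

lemma map_hist_slot_succ (n : ℕ) :
    (trajLaw L G θ init).map (fun ω => (hist (n + 1) ω, ω (n + 1))) =
      histLaw L G θ init (n + 1) ⊗ₘ
        (stateKernel D 𝒳 M init (n + 1) ⊗ₖ respond L G θ (n + 1)) := by
  let e : (Finset.Iic n → Slot S A 𝒳 M) → (Fin (n + 1) → Slot S A 𝒳 M) :=
    fun h k => h ⟨k, Finset.mem_Iic.2 (Nat.lt_succ_iff.1 k.2)⟩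
  have he : Measurable e := by fun_prop
  have hlaw : histLaw L G θ init (n + 1) =
      ((trajLaw L G θ init).map (Preorder.frestrictLe n)).map e := by
    rw [Measure.map_map he (by fun_prop)]
    rfl
  have hnext := Kernel.map_frestrictLe_trajMeasure_compProd_eq_map_trajMeasure
    (X := fun _ => Slot S A 𝒳 M) (μ₀ := firstSlot L G θ init)
    (κ := fun n => nextSlot L G θ n) (a := n)
  rw [hlaw, map_compProd_eq_map_compProd_comap _ he, ← nextSlot_eq_comap_stateKernel, trajLaw,
    hnext, Measure.map_map (by fun_prop) (by fun_prop)]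
  rfl

lemma map_hist_slot (n : ℕ) :
    (trajLaw L G θ init).map (fun ω => (hist n ω, ω n)) =
      histLaw L G θ init n ⊗ₘ (stateKernel D 𝒳 M init n ⊗ₖ respond L G θ n) := by
  cases n with
  | zero => exact map_hist_slot_zero L G θ init
  | succ n => exact map_hist_slot_succ L G θ init n

/-- The law of the records before slot `n` and of the state and the choice of slot `n`. -/
def choiceLaw (n : ℕ) : Measure (((Fin n → Slot S A 𝒳 M) × S) × (A × Fin M)) :=
  (histLaw L G θ init n ⊗ₘ stateKernel D 𝒳 M init n) ⊗ₘ L.choose n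

instance (n : ℕ) : IsProbabilityMeasure (choiceLaw L G θ init n) := by
  unfold choiceLaw
  infer_instance

lemma map_hist_state_choice_gain (n : ℕ) :
    (trajLaw L G θ init).map (fun ω => (((hist n ω, (ω n).1), (ω n).2.1), (ω n).2.2)) =
      choiceLaw L G θ init n ⊗ₘ (gainKernel G θ).comap (fun p => p.2.2) (by fun_prop) := by
  have hcomp : (fun ω : ℕ → Slot S A 𝒳 M => (((hist n ω, (ω n).1), (ω n).2.1), (ω n).2.2)) =
      MeasurableEquiv.prodAssoc.symm ∘ MeasurableEquiv.prodAssoc.symm ∘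
        fun ω => (hist n ω, ω n) := rfl
  rw [hcomp, ← Measure.map_map (by fun_prop) (by fun_prop),
    ← Measure.map_map (by fun_prop) (by fun_prop), map_hist_slot, Measure.compProd_assoc,
    respond, Measure.compProd_assoc, choiceLaw]

lemma map_hist_state_choice (n : ℕ) :
    (trajLaw L G θ init).map (fun ω => ((hist n ω, (ω n).1), (ω n).2.1)) =
      choiceLaw L G θ init n := by
  have hfst := congrArg Measure.fst (map_hist_state_choice_gain L G θ init n)
  rwa [Measure.fst_compProd, Measure.fst_map_prodMk (by fun_prop)] at hfst

lemma map_hist_state (n : ℕ) :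
    (trajLaw L G θ init).map (fun ω => (hist n ω, (ω n).1)) =
      histLaw L G θ init n ⊗ₘ stateKernel D 𝒳 M init n := by
  have hfst := congrArg Measure.fst (map_hist_state_choice L G θ init n)
  rwa [choiceLaw, Measure.fst_compProd, Measure.fst_map_prodMk (by fun_prop)] at hfst

lemma histLaw_succ (n : ℕ) :
    histLaw L G θ init (n + 1) = (choiceLaw L G θ init n ⊗ₘ
      (gainKernel G θ).comap (fun p => p.2.2) (by fun_prop)).map
        fun p => Fin.snoc (α := fun _ => Slot S A 𝒳 M) p.1.1.1 (p.1.1.2, (p.1.2, p.2)) := by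
  rw [← map_hist_state_choice_gain,
    Measure.map_map (measurable_finSnoc (by fun_prop) (by fun_prop)) (by fun_prop), histLaw]
  exact congrArg (Measure.map · _) (funext fun ω => (snoc_hist n ω).symm)

end History

/-! ### The number of plays and the change of measure -/

section Plays

open InformationTheory

lemma plays_eq_sum {S A 𝒳 : Type*} {M : ℕ} (i : Fin M) (T : ℕ) (ω : ℕ → Slot S A 𝒳 M) :
    (plays i T ω : ℝ) = ∑ t ∈ Finset.range T, if (ω t).2.1.2 = i then 1 else 0 :=
  (Finset.sum_boole _ _).symm

variable {S A Ψ 𝒳 : Type*} [MeasurableSpace S] [MeasurableSpace A] [MeasurableSpace 𝒳] {M : ℕ}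

lemma exists_measurable_plays_eq (i : Fin M) (T : ℕ) :
    ∃ N : (Fin T → Slot S A 𝒳 M) → ℝ, Measurable N ∧ ∀ ω, (plays i T ω : ℝ) = N (hist T ω) := by
  refine ⟨fun h => ∑ t, if (h t).2.1.2 = i then 1 else 0, Finset.measurable_sum _ fun t _ => ?_,
    fun ω => ?_⟩
  · exact (Measurable.of_discrete (f := fun j : Fin M => if j = i then (1 : ℝ) else 0)).comp
      (f := fun h : Fin T → Slot S A 𝒳 M => (h t).2.1.2) (by fun_prop)
  · rw [plays_eq_sum, Finset.sum_range]
    rfl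

variable {D : MDP S A} (L : AllocationRule D 𝒳 M) (G : GainModel Ψ A 𝒳) (θ : Fin M → Ψ)
  (init : Measure S) [IsProbabilityMeasure init]

lemma integrable_played (i : Fin M) (t : ℕ) :
    Integrable (fun ω => if (ω t).2.1.2 = i then (1 : ℝ) else 0) (trajLaw L G θ init) :=
  integrable_comp_of_finite _ (f := fun ω : ℕ → Slot S A 𝒳 M => (ω t).2.1.2) (by fun_prop)
    fun j => if j = i then 1 else 0

lemma integrable_plays (i : Fin M) (T : ℕ) :
    Integrable (fun ω => (plays i T ω : ℝ)) (trajLaw L G θ init) := by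
  simp only [plays_eq_sum]
  exact integrable_finsetSum _ fun t _ => integrable_played L G θ init i t

lemma klDiv_choiceLaw (θ' : Fin M → Ψ) (n : ℕ) :
    klDiv (choiceLaw L G θ init n) (choiceLaw L G θ' init n) =
      klDiv (histLaw L G θ init n) (histLaw L G θ' init n) := by
  rw [choiceLaw, choiceLaw, klDiv_compProd_left, klDiv_compProd_left]

lemma klDiv_compProd_gainKernel {θ' : Fin M → Ψ} (hac : ∀ j, G.law (θ j) ≪ G.law (θ' j)) (n : ℕ) :
    klDiv (choiceLaw L G θ init n ⊗ₘ (gainKernel G θ).comap (fun p => p.2.2) (by fun_prop))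
        (choiceLaw L G θ init n ⊗ₘ (gainKernel G θ').comap (fun p => p.2.2) (by fun_prop)) =
      ∫⁻ ω, G.I (θ (ω n).2.1.2) (θ' (ω n).2.1.2) ∂(trajLaw L G θ init) := by
  have hI : Measurable fun p : ((Fin n → Slot S A 𝒳 M) × S) × (A × Fin M) =>
      klDiv (gainKernel G θ p.2.2) (gainKernel G θ' p.2.2) :=
    (Measurable.of_discrete (f := fun j => klDiv (gainKernel G θ j) (gainKernel G θ' j))).comp
      (by fun_prop)
  rw [klDiv_compProd_comap _ hac, ← map_hist_state_choice]
  exact lintegral_map hI (by fun_prop)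

lemma klDiv_histLaw_le {θ' : Fin M → Ψ} (hac : ∀ j, G.law (θ j) ≪ G.law (θ' j)) (T : ℕ) :
    klDiv (histLaw L G θ init T) (histLaw L G θ' init T) ≤
      ∑ t ∈ Finset.range T, ∫⁻ ω, G.I (θ (ω t).2.1.2) (θ' (ω t).2.1.2) ∂(trajLaw L G θ init) := by
  induction T with
  | zero => rw [histLaw_zero, histLaw_zero, klDiv_self, Finset.sum_range_zero]
  | succ n ih =>
    rw [histLaw_succ, histLaw_succ, Finset.sum_range_succ,
      ← klDiv_compProd_gainKernel L G θ init hac]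
    refine (klDiv_map_le _ _ (measurable_finSnoc (by fun_prop) (by fun_prop))).trans ?_
    rw [klDiv_compProd_eq_add, klDiv_choiceLaw]
    gcongr

lemma klDiv_histLaw_update_le {i : Fin M} {ψ : Ψ} (hI : G.I (θ i) ψ ≠ ∞) (T : ℕ) :
    klDiv (histLaw L G θ init T) (histLaw L G (Function.update θ i ψ) init T) ≤
      G.I (θ i) ψ * ENNReal.ofReal (∫ ω, (plays i T ω : ℝ) ∂(trajLaw L G θ init)) := by
  have hac : ∀ j, G.law (θ j) ≪ G.law (Function.update θ i ψ j) := fun j => by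
    rcases eq_or_ne j i with rfl | hj
    · rw [Function.update_self]
      exact (klDiv_ne_top_iff.1 hI).1
    · rw [Function.update_of_ne hj]
  have hdiv : ∀ j, G.I (θ j) (Function.update θ i ψ j) =
      G.I (θ i) ψ * ENNReal.ofReal (if j = i then 1 else 0) := fun j => by
    rcases eq_or_ne j i with rfl | hj
    · rw [Function.update_self, if_pos rfl, ENNReal.ofReal_one, mul_one]
    · rw [Function.update_of_ne hj, if_neg hj, ENNReal.ofReal_zero, mul_zero, GainModel.I,
        klDiv_self]
  have hnonneg : ∀ j : Fin M, (0 : ℝ) ≤ if j = i then 1 else 0 := fun j => by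
    split_ifs <;> norm_num
  refine (klDiv_histLaw_le L G θ init hac T).trans_eq ?_
  simp only [hdiv, plays_eq_sum]
  rw [integral_finsetSum _ fun t _ => integrable_played L G θ init i t,
    ENNReal.ofReal_sum_of_nonneg fun t _ => integral_nonneg fun ω => hnonneg _, Finset.mul_sum]
  refine Finset.sum_congr rfl fun t _ => ?_
  rw [lintegral_const_mul' _ _ hI, ofReal_integral_eq_lintegral_ofReal
    (integrable_played L G θ init i t) (ae_of_all _ fun ω => hnonneg _)]

lemma mul_measureReal_plays_lt_le {i : Fin M} {ψ : Ψ} (hI : G.I (θ i) ψ ≠ ∞) (T : ℕ) (c a : ℝ) :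
    c * (trajLaw L G θ init).real {ω | plays i T ω < a} ≤
      (G.I (θ i) ψ).toReal * ∫ ω, (plays i T ω : ℝ) ∂(trajLaw L G θ init) +
        Real.log (1 + Real.exp c *
          (trajLaw L G (Function.update θ i ψ) init).real {ω | plays i T ω < a}) := by
  obtain ⟨N, hN, hplays⟩ := exists_measurable_plays_eq (S := S) (A := A) (𝒳 := 𝒳) i T
  have hE : MeasurableSet {h | N h < a} := measurableSet_lt hN measurable_const
  have hreal : ∀ θ, (trajLaw L G θ init).real {ω | plays i T ω < a} =
      (histLaw L G θ init T).real {h | N h < a} := fun θ => by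
    rw [histLaw, map_measureReal_apply (measurable_hist T) hE]
    simp only [hplays]
    rfl
  have hkl := klDiv_histLaw_update_le L G θ init hI T
  have hfin := ENNReal.mul_ne_top hI
    (ENNReal.ofReal_ne_top (r := ∫ ω, (plays i T ω : ℝ) ∂(trajLaw L G θ init)))
  rw [hreal, hreal]
  refine (mul_measureReal_le_klDiv_add_log (ne_top_of_le_ne_top hfin hkl) hE).trans ?_
  gcongr
  refine (ENNReal.toReal_mono hfin hkl).trans_eq ?_
  rw [ENNReal.toReal_mul, ENNReal.toReal_ofReal (integral_nonneg fun ω => Nat.cast_nonneg _)]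

end Plays

/-! ### Expected rewards -/

section Reward

lemma mean_eq_integral_law {Ψ A 𝒳 : Type*} [MeasurableSpace 𝒳] (G : GainModel Ψ A 𝒳) (a : A)
    (ψ : Ψ) : G.mean a ψ = ∫ x, G.f a x ∂(G.law ψ) := by
  rw [GainModel.law, integral_withDensity_eq_integral_toReal_smul
    (G.measurable_g ψ).ennreal_ofReal (ae_of_all _ fun _ => ENNReal.ofReal_lt_top)]
  simp only [ENNReal.toReal_ofReal (G.g_nonneg ψ _), smul_eq_mul, GainModel.mean, mul_comm]

lemma integrable_law {Ψ A 𝒳 : Type*} [MeasurableSpace 𝒳] {G : GainModel Ψ A 𝒳} (hA1 : G.A1)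
    (a : A) (ψ : Ψ) : Integrable (G.f a) (G.law ψ) := by
  rw [GainModel.law, integrable_withDensity_iff (G.measurable_g ψ).ennreal_ofReal
    (ae_of_all _ fun _ => ENNReal.ofReal_lt_top)]
  simpa only [ENNReal.toReal_ofReal (G.g_nonneg ψ _)] using hA1 ψ a

variable {S A Ψ 𝒳 : Type*} [MeasurableSpace S] [Finite A] [MeasurableSpace A]
  [MeasurableSingletonClass A] [MeasurableSpace 𝒳] {M : ℕ} {D : MDP S A}
  (L : AllocationRule D 𝒳 M) {G : GainModel Ψ A 𝒳} (θ : Fin M → Ψ)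
  (init : Measure S) [IsProbabilityMeasure init]

lemma integrable_rate_choiceLaw (hA1 : G.A1) (t : ℕ) :
    Integrable (fun p => G.f p.1.2.1 p.2)
      (choiceLaw L G θ init t ⊗ₘ (gainKernel G θ).comap (fun p => p.2.2) (by fun_prop)) := by
  have hmeas : Measurable fun p : (((Fin t → Slot S A 𝒳 M) × S) × (A × Fin M)) × 𝒳 =>
      G.f p.1.2.1 p.2 :=
    (measurable_from_prod_countable_right G.measurable_f :
      Measurable fun q : A × 𝒳 => G.f q.1 q.2).comp
      (f := fun p : (((Fin t → Slot S A 𝒳 M) × S) × (A × Fin M)) × 𝒳 => (p.1.2.1, p.2))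
      (by fun_prop)
  rw [Measure.integrable_compProd_iff hmeas.aestronglyMeasurable]
  refine ⟨ae_of_all _ fun p => integrable_law hA1 p.2.1 (θ p.2.2), ?_⟩
  exact integrable_comp_of_finite (choiceLaw L G θ init t) (f := Prod.snd) measurable_snd
    fun q => ∫ x, ‖G.f q.1 x‖ ∂(G.law (θ q.2))

lemma integrable_reward (hA1 : G.A1) (t : ℕ) :
    Integrable (reward G t) (trajLaw L G θ init) := by
  have hrate := integrable_rate_choiceLaw L θ init hA1 t
  rw [← map_hist_state_choice_gain] at hrate
  exact hrate.comp_measurable (by fun_prop)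

lemma integral_reward (hA1 : G.A1) (t : ℕ) :
    ∫ ω, reward G t ω ∂(trajLaw L G θ init) =
      ∫ ω, G.mean (ω t).2.1.1 (θ (ω t).2.1.2) ∂(trajLaw L G θ init) := by
  have hrate := integrable_rate_choiceLaw L θ init hA1 t
  have hmean := integrable_comp_of_finite (choiceLaw L G θ init t) measurable_snd
    fun q => G.mean q.1 (θ q.2)
  calc ∫ ω, reward G t ω ∂(trajLaw L G θ init)
      = ∫ p, G.f p.1.2.1 p.2 ∂(choiceLaw L G θ init t ⊗ₘ
          (gainKernel G θ).comap (fun p => p.2.2) (by fun_prop)) := by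
        rw [← map_hist_state_choice_gain] at hrate ⊢
        exact (integral_map (by fun_prop) hrate.aestronglyMeasurable).symm
    _ = ∫ p, G.mean p.2.1 (θ p.2.2) ∂(choiceLaw L G θ init t) := by
        rw [Measure.integral_compProd hrate]
        exact integral_congr_ae (ae_of_all _ fun p =>
          (mean_eq_integral_law G p.2.1 (θ p.2.2)).symm)
    _ = ∫ ω, G.mean (ω t).2.1.1 (θ (ω t).2.1.2) ∂(trajLaw L G θ init) := by
        rw [← map_hist_state_choice] at hmean ⊢
        exact integral_map (by fun_prop) hmean.aestronglyMeasurable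

end Reward

/-! ### The innovations of the state process -/

section Innovation

lemma integral_sum_sq_eq_of_orthogonal {X ι : Type*} [MeasurableSpace X] {μ : Measure X}
    {ξ : ι → X → ℝ} (hξ : ∀ t, MemLp (ξ t) 2 μ)
    (horth : Pairwise fun m n => ∫ x, ξ m x * ξ n x ∂μ = 0) (s : Finset ι) :
    ∫ x, (∑ t ∈ s, ξ t x) ^ 2 ∂μ = ∑ t ∈ s, ∫ x, ξ t x ^ 2 ∂μ := by
  have hint : ∀ m n, Integrable (fun x => ξ m x * ξ n x) μ := fun m n =>
    (hξ m).integrable_mul (hξ n)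
  simp only [sq, Finset.sum_mul_sum]
  rw [integral_finsetSum _ fun m _ => integrable_finsetSum _ fun n _ => hint m n]
  refine Finset.sum_congr rfl fun m hm => ?_
  rw [integral_finsetSum _ fun n _ => hint m n]
  exact Finset.sum_eq_single m (fun n _ hn => horth hn.symm) fun h => absurd hm h

variable {S A Ψ 𝒳 : Type*} [Finite S] [MeasurableSpace S] [MeasurableSingletonClass S]
  [Finite A] [MeasurableSpace A] [MeasurableSingletonClass A] [MeasurableSpace 𝒳] {M : ℕ}
  {D : MDP S A}

/-- The innovation `u(s_{t+1}) - E[u(s_{t+1}) | s_t, a_t]` of the state function `u` after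
slot `t`. -/
def innovation {S A 𝒳 : Type*} [MeasurableSpace S] [MeasurableSpace A] {M : ℕ} (D : MDP S A)
    (u : S → ℝ) (t : ℕ) (ω : ℕ → Slot S A 𝒳 M) : ℝ :=
  u (ω (t + 1)).1 - D.expNext u (ω t).1 (ω t).2.1.1

/-- The martingale `∑_{t < T} (u(s_{t+1}) - E[u(s_{t+1}) | s_t, a_t])`. -/
def innovationSum {S A 𝒳 : Type*} [MeasurableSpace S] [MeasurableSpace A] {M : ℕ} (D : MDP S A)
    (u : S → ℝ) (T : ℕ) (ω : ℕ → Slot S A 𝒳 M) : ℝ :=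
  ∑ t ∈ Finset.range T, innovation D u t ω

variable (L : AllocationRule D 𝒳 M) (G : GainModel Ψ A 𝒳) (θ : Fin M → Ψ)
  (init : Measure S) [IsProbabilityMeasure init] (u : S → ℝ)

lemma memLp_innovation (t : ℕ) (p : ℝ≥0∞) :
    MemLp (innovation D u t) p (trajLaw L G θ init) :=
  memLp_comp_of_finite _
    (f := fun ω : ℕ → Slot S A 𝒳 M => ((ω (t + 1)).1, (ω t).1, (ω t).2.1.1)) (by fun_prop)
    (fun q => u q.1 - D.expNext u q.2.1 q.2.2) p

lemma integral_mul_innovation (n : ℕ) (W : (Fin (n + 1) → S × A) → ℝ) :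
    ∫ ω, W (fun k => ((ω k).1, (ω k).2.1.1)) * innovation D u n ω ∂(trajLaw L G θ init) = 0 := by
  let Φ : (Fin (n + 1) → S × A) × S → ℝ := fun q =>
    W q.1 * (u q.2 - D.expNext u (q.1 (Fin.last n)).1 (q.1 (Fin.last n)).2)
  let e : (Fin (n + 1) → Slot S A 𝒳 M) × S → (Fin (n + 1) → S × A) × S := fun p =>
    (fun k => ((p.1 k).1, (p.1 k).2.1.1), p.2)
  have hint : Integrable (fun p => Φ (e p))
      (histLaw L G θ init (n + 1) ⊗ₘ stateKernel D 𝒳 M init (n + 1)) :=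
    integrable_comp_of_finite _ (by fun_prop) Φ
  calc ∫ ω, W (fun k => ((ω k).1, (ω k).2.1.1)) * innovation D u n ω ∂(trajLaw L G θ init)
      = ∫ p, Φ (e p) ∂(histLaw L G θ init (n + 1) ⊗ₘ stateKernel D 𝒳 M init (n + 1)) := by
        rw [← map_hist_state] at hint ⊢
        exact (integral_map (by fun_prop) hint.aestronglyMeasurable).symm
    _ = ∫ h, ∫ s, Φ (e (h, s)) ∂(stateKernel D 𝒳 M init (n + 1) h)
          ∂(histLaw L G θ init (n + 1)) := Measure.integral_compProd hint
    _ = 0 := by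
        refine integral_eq_zero_of_ae (ae_of_all _ fun h => ?_)
        change ∫ s, W (fun k => ((h k).1, (h k).2.1.1)) *
          (u s - D.expNext u (h (Fin.last n)).1 (h (Fin.last n)).2.1.1)
          ∂(D.trans ((h (Fin.last n)).1, (h (Fin.last n)).2.1.1)) = 0
        rw [integral_const_mul, integral_sub .of_finite (integrable_const _), integral_const,
          probReal_univ, one_smul, MDP.expNext, sub_self, mul_zero]

lemma integral_innovation (n : ℕ) :
    ∫ ω, innovation D u n ω ∂(trajLaw L G θ init) = 0 := by
  simpa only [one_mul] using integral_mul_innovation L G θ init u n fun _ => 1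

lemma integral_innovation_mul_innovation :
    Pairwise fun m n => ∫ ω, innovation D u m ω * innovation D u n ω ∂(trajLaw L G θ init) = 0 := by
  have hlt : ∀ m n, m < n →
      ∫ ω, innovation D u m ω * innovation D u n ω ∂(trajLaw L G θ init) = 0 := fun m n hmn =>
    integral_mul_innovation L G θ init u n fun q =>
      u (q ⟨m + 1, by omega⟩).1 - D.expNext u (q ⟨m, by omega⟩).1 (q ⟨m, by omega⟩).2
  intro m n hmn
  rcases hmn.lt_or_gt with h | h
  · exact hlt m n h
  · simpa only [mul_comm] using hlt n m h

lemma memLp_innovationSum (T : ℕ) (p : ℝ≥0∞) :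
    MemLp (innovationSum D u T) p (trajLaw L G θ init) :=
  memLp_finsetSum _ fun t _ => memLp_innovation L G θ init u t p

lemma exists_integral_innovationSum_sq_le :
    ∃ K : ℝ, ∀ T : ℕ, ∫ ω, innovationSum D u T ω ^ 2 ∂(trajLaw L G θ init) ≤ K * T := by
  obtain ⟨K, hK⟩ := Finite.bddAbove_range fun q : S × S × A =>
    (u q.1 - D.expNext u q.2.1 q.2.2) ^ 2
  have hinnovation : ∀ t, ∫ ω, innovation D u t ω ^ 2 ∂(trajLaw L G θ init) ≤ K := fun t => by
    refine (integral_mono (memLp_innovation L G θ init u t 2).integrable_sq (integrable_const K)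
      fun ω => hK ⟨((ω (t + 1)).1, (ω t).1, (ω t).2.1.1), rfl⟩).trans_eq ?_
    rw [integral_const, probReal_univ, one_smul]
  refine ⟨K, fun T => ?_⟩
  simp only [innovationSum]
  rw [integral_sum_sq_eq_of_orthogonal (fun t => memLp_innovation L G θ init u t 2)
    (integral_innovation_mul_innovation L G θ init u)]
  calc ∑ t ∈ Finset.range T, ∫ ω, innovation D u t ω ^ 2 ∂(trajLaw L G θ init)
      ≤ ∑ _t ∈ Finset.range T, K := Finset.sum_le_sum fun t _ => hinnovation t
    _ = K * T := by rw [Finset.sum_const, Finset.card_range, nsmul_eq_mul, mul_comm]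

end Innovation

/-! ### The gap in the optimality inequality -/

section Benchmark

variable {A Ψ 𝒳 : Type*} [MeasurableSpace 𝒳] {M : ℕ} (G : GainModel Ψ A 𝒳) (θ : Fin M → Ψ)

lemma mean_le_bestMean (a : A) (j : Fin M) : G.mean a (θ j) ≤ bestMean G θ a :=
  le_ciSup (f := fun j => G.mean a (θ j)) (Finite.bddAbove_range _) j

lemma exists_mean_eq_bestMean [Nonempty (Fin M)] (a : A) : ∃ j, G.mean a (θ j) = bestMean G θ a :=
  exists_eq_ciSup_of_finite

variable {S : Type*} [Fintype S] [MeasurableSpace S] [Finite A] [MeasurableSpace A]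
  (D : MDP S A)

lemma avgReward_le_optReward (β : D.Policy) : avgReward D G θ β ≤ optReward D G θ :=
  le_ciSup (f := fun β => avgReward D G θ β) (Finite.bddAbove_range _) β

lemma exists_avgReward_eq_optReward : ∃ β : D.Policy, avgReward D G θ β = optReward D G θ :=
  exists_eq_ciSup_of_finite

end Benchmark

section Supersolution

variable {S A Ψ 𝒳 : Type*} [MeasurableSpace S] [MeasurableSpace A] [MeasurableSpace 𝒳] {M : ℕ}

/-- The average-reward optimality inequality for the parameters `θ`: in every state `s`, an allowed
action and a channel earn, on average and together with the change of the bias `h`, at most `ρ`. -/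
def IsSupersolution (D : MDP S A) (G : GainModel Ψ A 𝒳) (θ : Fin M → Ψ) (ρ : ℝ) (h : S → ℝ) :
    Prop :=
  ∀ s, ∀ a ∈ D.allowed s, ∀ j, G.mean a (θ j) + D.expNext h s a ≤ ρ + h s

/-- The slack in the optimality inequality for `(ρ, h)` at the state, the action and the channel of
a slot, that is, the loss caused by the choice made there. -/
def bellmanGap (D : MDP S A) (G : GainModel Ψ A 𝒳) (θ : Fin M → Ψ) (ρ : ℝ) (h : S → ℝ)
    (x : Slot S A 𝒳 M) : ℝ :=
  ρ + h x.1 - (G.mean x.2.1.1 (θ x.2.1.2) + D.expNext h x.1 x.2.1.1)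

lemma IsSupersolution.bellmanGap_nonneg {D : MDP S A} {G : GainModel Ψ A 𝒳} {θ : Fin M → Ψ} {ρ : ℝ}
    {h : S → ℝ} (hh : IsSupersolution D G θ ρ h) {x : Slot S A 𝒳 M}
    (hx : x.2.1.1 ∈ D.allowed x.1) : 0 ≤ bellmanGap D G θ ρ h x :=
  sub_nonneg.2 (hh _ _ hx _)

lemma sum_sub_expNext {S A 𝒳 : Type*} [MeasurableSpace S] [MeasurableSpace A] (D : MDP S A)
    (u : S → ℝ) (T : ℕ) (ω : ℕ → Slot S A 𝒳 M) :
    ∑ t ∈ Finset.range T, (u (ω t).1 - D.expNext u (ω t).1 (ω t).2.1.1) =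
      u (ω 0).1 - u (ω T).1 + innovationSum D u T ω := by
  rw [innovationSum, ← Finset.sum_range_sub' (fun t => u (ω t).1), ← Finset.sum_add_distrib]
  exact Finset.sum_congr rfl fun t _ => by rw [innovation]; ring

lemma sum_bellmanGap (D : MDP S A) (G : GainModel Ψ A 𝒳) (θ : Fin M → Ψ) (ρ : ℝ) (h : S → ℝ)
    (T : ℕ) (ω : ℕ → Slot S A 𝒳 M) :
    ∑ t ∈ Finset.range T, bellmanGap D G θ ρ h (ω t) =
      T * ρ - ∑ t ∈ Finset.range T, G.mean (ω t).2.1.1 (θ (ω t).2.1.2) +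
        (h (ω 0).1 - h (ω T).1 + innovationSum D h T ω) := by
  have hconst : (T : ℝ) * ρ = ∑ _t ∈ Finset.range T, ρ := by
    rw [Finset.sum_const, Finset.card_range, nsmul_eq_mul]
  rw [← sum_sub_expNext, hconst, ← Finset.sum_sub_distrib, ← Finset.sum_add_distrib]
  exact Finset.sum_congr rfl fun t _ => by rw [bellmanGap]; ring

lemma exists_isSupersolution [Fintype S] [MeasurableSingletonClass S] [DecidableEq S] [Nonempty S]
    [Finite A] {D : MDP S A} (hD : D.IsIrreducible) (G : GainModel Ψ A 𝒳) (θ : Fin M → Ψ) :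
    ∃ h, IsSupersolution D G θ (optReward D G θ) h := by
  obtain ⟨β, hβ⟩ := exists_avgReward_eq_optReward G θ D
  obtain ⟨h, hh⟩ := MDP.exists_bias hD (r := fun _ => bestMean G θ) (β := β) fun β' =>
    (avgReward_le_optReward G θ D β').trans_eq hβ.symm
  refine ⟨h, fun s a ha j => ?_⟩
  rw [← hβ]
  exact (add_le_add_left (mean_le_bestMean G θ a j) _).trans (hh s a ha)

lemma IsSupersolution.exists_le_bellmanGap_add [Finite S] [MeasurableSingletonClass S] [Finite A]
    {D : MDP S A} {G : GainModel Ψ A 𝒳} {θ θ' : Fin M → Ψ} {i : Fin M} {ρ' : ℝ} {h' : S → ℝ}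
    (hθ : ∀ k ≠ i, θ' k = θ k) (hh' : IsSupersolution D G θ' ρ' h') (ρ : ℝ) (h : S → ℝ) :
    ∃ K > 0, ∀ x : Slot S A 𝒳 M, x.2.1.1 ∈ D.allowed x.1 →
      ρ - ρ' + ((h - h') x.1 - D.expNext (h - h') x.1 x.2.1.1) ≤
        bellmanGap D G θ ρ h x + K * if x.2.1.2 = i then 1 else 0 := by
  obtain ⟨K, hK⟩ := Finite.bddAbove_range fun a => G.mean a (θ i) - G.mean a (θ' i)
  refine ⟨max K 1, lt_max_of_lt_right one_pos, fun x hx => ?_⟩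
  have hexp : D.expNext (h - h') x.1 x.2.1.1 =
      D.expNext h x.1 x.2.1.1 - D.expNext h' x.1 x.2.1.1 :=
    integral_sub .of_finite .of_finite
  have hsuper := hh' _ _ hx x.2.1.2
  rw [hexp, bellmanGap, Pi.sub_apply]
  split_ifs with hi
  · have hmean : G.mean x.2.1.1 (θ i) - G.mean x.2.1.1 (θ' i) ≤ K := hK ⟨_, rfl⟩
    rw [hi] at hsuper ⊢
    linarith [le_max_left K 1]
  · rw [hθ _ hi] at hsuper
    linarith

end Supersolution

section Paths

variable {S A Ψ 𝒳 : Type*} [Finite S] [MeasurableSpace S] [MeasurableSingletonClass S] [Finite A]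
  [MeasurableSpace A] [MeasurableSingletonClass A] [MeasurableSpace 𝒳] {M : ℕ} {D : MDP S A}
  (L : AllocationRule D 𝒳 M) (G : GainModel Ψ A 𝒳) (θ : Fin M → Ψ) (init : Measure S)
  [IsProbabilityMeasure init]

lemma ae_mem_allowed :
    ∀ᵐ ω ∂(trajLaw L G θ init), ∀ t, (ω t).2.1.1 ∈ D.allowed (ω t).1 := by
  refine ae_all_iff.2 fun t => ?_
  have hset : MeasurableSet {p : ((Fin t → Slot S A 𝒳 M) × S) × (A × Fin M) |
      p.2.1 ∈ D.allowed p.1.2} :=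
    (Set.to_countable {q : S × A | q.2 ∈ D.allowed q.1}).measurableSet.preimage
      (f := fun p : ((Fin t → Slot S A 𝒳 M) × S) × (A × Fin M) => (p.1.2, p.2.1)) (by fun_prop)
  have hchoice : ∀ᵐ p ∂(choiceLaw L G θ init t), p.2.1 ∈ D.allowed p.1.2 :=
    Measure.ae_compProd_of_ae_ae hset (ae_of_all _ fun p => L.choose_allowed t p.1 p.2)
  rw [← map_hist_state_choice] at hchoice
  exact ae_of_ae_map (by fun_prop) hchoice

lemma integrable_sum_bellmanGap (ρ : ℝ) (h : S → ℝ) (T : ℕ) :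
    Integrable (fun ω => ∑ t ∈ Finset.range T, bellmanGap D G θ ρ h (ω t))
      (trajLaw L G θ init) :=
  integrable_finsetSum _ fun t _ => integrable_comp_of_finite _
    (f := fun ω : ℕ → Slot S A 𝒳 M => ((ω t).1, (ω t).2.1)) (by fun_prop)
    fun q => ρ + h q.1 - (G.mean q.2.1 (θ q.2.2) + D.expNext h q.1 q.2.1)

lemma exists_mul_le_sum_bellmanGap_add {G θ} {θ' : Fin M → Ψ} {i : Fin M} (hθ : ∀ k ≠ i, θ' k = θ k)
    {ρ' : ℝ} {h' : S → ℝ} (hh' : IsSupersolution D G θ' ρ' h') (ρ : ℝ) (h : S → ℝ) :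
    ∃ K > 0, ∃ B ≥ 0, ∀ T : ℕ, ∀ᵐ ω ∂(trajLaw L G θ init),
      (ρ - ρ') * T ≤ ∑ t ∈ Finset.range T, bellmanGap D G θ ρ h (ω t) + K * plays i T ω + B +
        |innovationSum D (h - h') T ω| := by
  obtain ⟨K, hK0, hK⟩ := hh'.exists_le_bellmanGap_add hθ ρ h
  obtain ⟨B, hB⟩ := Finite.bddAbove_range fun q : S × S => (h - h') q.2 - (h - h') q.1
  refine ⟨K, hK0, max B 0, le_max_right _ _, fun T => ?_⟩
  filter_upwards [ae_mem_allowed L G θ init] with ω hω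
  have hslots := Finset.sum_le_sum fun t (_ : t ∈ Finset.range T) => hK (ω t) (hω t)
  have hends : (h - h') (ω T).1 - (h - h') (ω 0).1 ≤ B := hB ⟨((ω 0).1, (ω T).1), rfl⟩
  rw [Finset.sum_add_distrib, Finset.sum_add_distrib, Finset.sum_const, Finset.card_range,
    nsmul_eq_mul, sum_sub_expNext, ← Finset.mul_sum, ← plays_eq_sum] at hslots
  linarith [le_max_left B 0, neg_abs_le (innovationSum D (h - h') T ω)]

lemma exists_plays_lt_imp_le_sum_bellmanGap_add {θ' : Fin M → Ψ} {i : Fin M}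
    (hθ : ∀ k ≠ i, θ' k = θ k) {ρ ρ' : ℝ} (hρ : ρ' < ρ) {h' : S → ℝ}
    (hh' : IsSupersolution D G θ' ρ' h') (h : S → ℝ) :
    ∃ η > (0 : ℝ), ∃ B ≥ 0, ∀ T : ℕ, 0 < T → ∀ᵐ ω ∂(trajLaw L G θ init), plays i T ω < η * T →
      (ρ - ρ') / 2 * T ≤ ∑ t ∈ Finset.range T, bellmanGap D G θ ρ h (ω t) +
        innovationSum D (h - h') T ω ^ 2 / ((ρ - ρ') * T) + B := by
  obtain ⟨K, hK, B, hB, hpath⟩ := exists_mul_le_sum_bellmanGap_add L init hθ hh' ρ h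
  have hΔ : 0 < ρ - ρ' := sub_pos.2 hρ
  refine ⟨(ρ - ρ') / (4 * K), by positivity, B, hB, fun T hT => ?_⟩
  filter_upwards [hpath T] with ω hω hplays
  have hKplays : K * plays i T ω ≤ (ρ - ρ') * T / 4 :=
    (mul_le_mul_of_nonneg_left hplays.le hK.le).trans_eq (by field_simp)
  have hamgm : |innovationSum D (h - h') T ω| ≤
      (ρ - ρ') * T / 4 + innovationSum D (h - h') T ω ^ 2 / ((ρ - ρ') * T) := by
    rw [← sub_le_iff_le_add', le_div_iff₀ (mul_pos hΔ (Nat.cast_pos.2 hT)),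
      ← sq_abs (innovationSum D (h - h') T ω)]
    nlinarith [sq_nonneg (|innovationSum D (h - h') T ω| - (ρ - ρ') * T / 2)]
  linarith

end Paths

section Regret

variable {S A Ψ 𝒳 : Type*} [Fintype S] [MeasurableSpace S] [MeasurableSingletonClass S] [Finite A]
  [MeasurableSpace A] [MeasurableSingletonClass A] [MeasurableSpace 𝒳] {M : ℕ} {D : MDP S A}
  (L : AllocationRule D 𝒳 M) {G : GainModel Ψ A 𝒳} (θ : Fin M → Ψ) (init : Measure S)
  [IsProbabilityMeasure init]

lemma integral_sum_bellmanGap (hA1 : G.A1) (h : S → ℝ) (T : ℕ) :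
    ∫ ω, ∑ t ∈ Finset.range T, bellmanGap D G θ (optReward D G θ) h (ω t) ∂(trajLaw L G θ init) =
      regret L G θ init T + ∫ ω, (h (ω 0).1 - h (ω T).1) ∂(trajLaw L G θ init) := by
  have hmean : ∀ t, Integrable (fun ω => G.mean (ω t).2.1.1 (θ (ω t).2.1.2))
      (trajLaw L G θ init) := fun t =>
    integrable_comp_of_finite _ (f := fun ω : ℕ → Slot S A 𝒳 M => (ω t).2.1) (by fun_prop)
      fun q => G.mean q.1 (θ q.2)
  have hsum := integrable_finsetSum (Finset.range T) fun t _ => hmean t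
  have hends : Integrable (fun ω => h (ω 0).1 - h (ω T).1) (trajLaw L G θ init) :=
    integrable_comp_of_finite _ (f := fun ω : ℕ → Slot S A 𝒳 M => ((ω 0).1, (ω T).1))
      (by fun_prop) fun q => h q.1 - h q.2
  have hinnov : Integrable (innovationSum D h T) (trajLaw L G θ init) :=
    (memLp_innovationSum L G θ init h T 1).integrable le_rfl
  have hinnov_zero : ∫ ω, innovationSum D h T ω ∂(trajLaw L G θ init) = 0 := by
    simp only [innovationSum]
    rw [integral_finsetSum _ fun t _ => (memLp_innovation L G θ init h t 1).integrable le_rfl]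
    exact Finset.sum_eq_zero fun t _ => integral_innovation L G θ init h t
  simp only [sum_bellmanGap]
  rw [integral_add (by fun_prop) (by fun_prop), integral_add hends hinnov, hinnov_zero,
    integral_sub (integrable_const _) hsum, integral_const, probReal_univ, one_smul, regret,
    add_zero, integral_finsetSum _ fun t _ => hmean t,
    integral_finsetSum _ fun t _ => integrable_reward L θ init hA1 t]
  simp only [integral_reward L θ init hA1]

lemma exists_integral_sum_bellmanGap_le (hA1 : G.A1) (h : S → ℝ) :
    ∃ B, ∀ T, ∫ ω, ∑ t ∈ Finset.range T, bellmanGap D G θ (optReward D G θ) h (ω t)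
      ∂(trajLaw L G θ init) ≤ regret L G θ init T + B := by
  obtain ⟨B, hB⟩ := Finite.bddAbove_range fun q : S × S => h q.1 - h q.2
  refine ⟨B, fun T => ?_⟩
  rw [integral_sum_bellmanGap L θ init hA1]
  gcongr
  calc ∫ ω, (h (ω 0).1 - h (ω T).1) ∂(trajLaw L G θ init)
      ≤ ∫ _ω, B ∂(trajLaw L G θ init) := integral_mono
        (integrable_comp_of_finite _ (f := fun ω : ℕ → Slot S A 𝒳 M => ((ω 0).1, (ω T).1))
          (by fun_prop) fun q => h q.1 - h q.2)
        (integrable_const B) fun ω => hB ⟨((ω 0).1, (ω T).1), rfl⟩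
    _ = B := by rw [integral_const, probReal_univ, one_smul]

lemma exists_integral_sum_bellmanGap_add_sq_le (hA1 : G.A1) (h u : S → ℝ) {Δ : ℝ} (hΔ : 0 < Δ) :
    ∃ B, ∀ T : ℕ, 0 < T →
      ∫ ω, (∑ t ∈ Finset.range T, bellmanGap D G θ (optReward D G θ) h (ω t) +
        innovationSum D u T ω ^ 2 / (Δ * T)) ∂(trajLaw L G θ init) ≤ regret L G θ init T + B := by
  obtain ⟨B, hB⟩ := exists_integral_sum_bellmanGap_le L θ init hA1 h
  obtain ⟨K, hK⟩ := exists_integral_innovationSum_sq_le L G θ init u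
  refine ⟨B + K / Δ, fun T hT => ?_⟩
  have hsq : (∫ ω, innovationSum D u T ω ^ 2 ∂(trajLaw L G θ init)) / (Δ * T) ≤ K / Δ := by
    rw [div_le_div_iff₀ (mul_pos hΔ (Nat.cast_pos.2 hT)) hΔ]
    linarith [mul_le_mul_of_nonneg_right (hK T) hΔ.le]
  rw [integral_add (integrable_sum_bellmanGap L G θ init _ h T)
    ((memLp_innovationSum L G θ init u T 2).integrable_sq.div_const _), integral_div]
  linarith [hB T]

lemma exists_mul_measureReal_plays_lt_le [DecidableEq S] (hD : D.IsIrreducible) (hA1 : G.A1)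
    {θ' : Fin M → Ψ} {i : Fin M} (hθ : ∀ k ≠ i, θ' k = θ k)
    (hlt : optReward D G θ' < optReward D G θ) :
    ∃ η > (0 : ℝ), ∃ c > 0, ∃ B, ∀ T : ℕ, 0 < T →
      c * T * (trajLaw L G θ init).real {ω | plays i T ω < η * T} ≤ regret L G θ init T + B := by
  have := nonempty_of_isProbabilityMeasure init
  obtain ⟨h, hh⟩ := exists_isSupersolution hD G θ
  obtain ⟨h', hh'⟩ := exists_isSupersolution hD G θ'
  set Δ := optReward D G θ - optReward D G θ'
  have hΔ : 0 < Δ := sub_pos.2 hlt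
  obtain ⟨η, hη, B, hB, hpath⟩ :=
    exists_plays_lt_imp_le_sum_bellmanGap_add L G θ init hθ hlt hh' h
  obtain ⟨B', hB'⟩ := exists_integral_sum_bellmanGap_add_sq_le L θ init hA1 h (h - h') hΔ
  refine ⟨η, hη, Δ / 2, by positivity, B' + B, fun T hT => ?_⟩
  let Y : (ℕ → Slot S A 𝒳 M) → ℝ := fun ω =>
    ∑ t ∈ Finset.range T, bellmanGap D G θ (optReward D G θ) h (ω t) +
      innovationSum D (h - h') T ω ^ 2 / (Δ * T)
  have hYint : Integrable Y (trajLaw L G θ init) :=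
    (integrable_sum_bellmanGap L G θ init _ h T).add
      ((memLp_innovationSum L G θ init (h - h') T 2).integrable_sq.div_const _)
  have hYnonneg : ∀ᵐ ω ∂(trajLaw L G θ init), 0 ≤ Y ω + B := by
    filter_upwards [ae_mem_allowed L G θ init] with ω hω
    have hgap := Finset.sum_nonneg fun t (_ : t ∈ Finset.range T) => hh.bellmanGap_nonneg (hω t)
    positivity
  calc Δ / 2 * T * (trajLaw L G θ init).real {ω | plays i T ω < η * T}
      ≤ Δ / 2 * T * (trajLaw L G θ init).real {ω | Δ / 2 * T ≤ Y ω + B} :=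
        mul_le_mul_of_nonneg_left (ENNReal.toReal_mono (measure_ne_top _ _)
          (measure_mono_ae (hpath T hT))) (by positivity)
    _ ≤ ∫ ω, (Y ω + B) ∂(trajLaw L G θ init) :=
        mul_meas_ge_le_integral_of_nonneg hYnonneg (hYint.add (integrable_const B)) _
    _ ≤ regret L G θ init T + (B' + B) := by
        rw [integral_add hYint (integrable_const B), integral_const, probReal_univ, one_smul]
        linarith [hB' T hT]

lemma exists_measureReal_plays_lt_le_rpow [DecidableEq S] (hD : D.IsIrreducible) (hA1 : G.A1)
    {θ' : Fin M → Ψ} {i : Fin M} (hθ : ∀ k ≠ i, θ' k = θ k)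
    (hlt : optReward D G θ' < optReward D G θ) {b : ℝ} (hb : 0 ≤ b)
    (hL : (fun T : ℕ => regret L G θ init T) =O[atTop] fun T : ℕ => (T : ℝ) ^ b) :
    ∃ η > (0 : ℝ), ∃ C, ∀ᶠ T : ℕ in atTop,
      (trajLaw L G θ init).real {ω | plays i T ω < η * T} ≤ C * (T : ℝ) ^ (b - 1) := by
  obtain ⟨η, hη, c, hc, B, hrare⟩ := exists_mul_measureReal_plays_lt_le L θ init hD hA1 hθ hlt
  obtain ⟨R, hR⟩ := hL.bound
  refine ⟨η, hη, (R + |B|) / c, ?_⟩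
  filter_upwards [hR, eventually_ge_atTop 1] with T hregret hT
  have hT1 : (1 : ℝ) ≤ T := Nat.one_le_cast.2 hT
  have hpow : 1 ≤ (T : ℝ) ^ b := Real.one_le_rpow hT1 hb
  rw [Real.norm_eq_abs, Real.norm_of_nonneg (by linarith)] at hregret
  rw [Real.rpow_sub_one (by linarith), div_mul_div_comm, le_div_iff₀' (by positivity)]
  calc c * T * (trajLaw L G θ init).real {ω | plays i T ω < η * T}
      ≤ regret L G θ init T + B := hrare T hT
    _ ≤ R * (T : ℝ) ^ b + |B| * (T : ℝ) ^ b :=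
        add_le_add ((le_abs_self _).trans hregret)
          ((le_abs_self B).trans (le_mul_of_one_le_right (abs_nonneg B) hpow))
    _ = (R + |B|) * (T : ℝ) ^ b := (add_mul _ _ _).symm

end Regret

/-! ### The lower bound -/

section LowerBound

lemma one_sub_div_le_measureReal_lt {X : Type*} [MeasurableSpace X] {μ : Measure X}
    [IsProbabilityMeasure μ] {f : X → ℝ} (hf : 0 ≤ᵐ[μ] f) (hint : Integrable f μ) {a : ℝ}
    (ha : 0 < a) : 1 - (∫ x, f x ∂μ) / a ≤ μ.real {x | f x < a} := by
  have hmarkov : μ.real {x | a ≤ f x} ≤ (∫ x, f x ∂μ) / a :=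
    (le_div_iff₀' ha).2 (mul_meas_ge_le_integral_of_nonneg hf hint a)
  have hcover : {x | f x < a} ∪ {x | a ≤ f x} = Set.univ :=
    Set.eq_univ_of_forall fun x => lt_or_ge (f x) a
  have hunion := measureReal_union_le (μ := μ) {x | f x < a} {x | a ≤ f x}
  rw [hcover, probReal_univ] at hunion
  linarith

lemma eventually_le_div_log {x : ℕ → ℝ} {I η d C c : ℝ} (hI : 0 ≤ I) (hη : 0 < η) (hd : 0 < d)
    (hc : c * I < d)
    (h : ∀ᶠ T : ℕ in atTop, d * Real.log T * (1 - x T / (η * T)) ≤ I * x T + C) :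
    ∀ᶠ T : ℕ in atTop, c ≤ x T / Real.log T := by
  have hlog : Tendsto (fun T : ℕ => Real.log T) atTop atTop :=
    Real.tendsto_log_atTop.comp tendsto_natCast_atTop_atTop
  have hdiv : Tendsto (fun T : ℕ => Real.log T / T) atTop (nhds 0) :=
    Real.isLittleO_log_id_atTop.tendsto_div_nhds_zero.comp tendsto_natCast_atTop_atTop
  have hlim : Tendsto (fun T : ℕ => d * (1 - c / η * (Real.log T / T)) - C / Real.log T) atTop
      (nhds (d * (1 - c / η * 0) - 0)) :=
    (((hdiv.const_mul _).const_sub 1).const_mul d).sub (hlog.const_div_atTop C)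
  rw [mul_zero, sub_zero, sub_zero, mul_one] at hlim
  filter_upwards [h, hlim.eventually_const_lt hc, hlog.eventually_gt_atTop 0,
    eventually_gt_atTop 0] with T hx hgap hlogT hT
  by_contra! hlt
  rw [div_lt_iff₀ hlogT] at hlt
  have hupper : d * Real.log T * (1 - c * Real.log T / (η * T)) ≤ I * (c * Real.log T) + C :=
    calc d * Real.log T * (1 - c * Real.log T / (η * T))
        ≤ d * Real.log T * (1 - x T / (η * T)) := by gcongr
      _ ≤ I * x T + C := hx
      _ ≤ I * (c * Real.log T) + C := by gcongr
  have hlower : c * I * Real.log T < d * Real.log T * (1 - c * Real.log T / (η * T)) - C :=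
    (mul_lt_mul_of_pos_right hgap hlogT).trans_eq (by field_simp)
  linarith

variable {S A Ψ 𝒳 : Type*} [MeasurableSpace S] [MeasurableSpace A] [MeasurableSpace 𝒳] {M : ℕ}
  {D : MDP S A} (L : AllocationRule D 𝒳 M) {G : GainModel Ψ A 𝒳} (init : Measure S)
  [IsProbabilityMeasure init]

lemma log_mul_one_sub_le {θ : Fin M → Ψ} {i : Fin M} {ψ : Ψ} (hI : G.I (θ i) ψ ≠ ∞) {η b C : ℝ}
    (hη : 0 < η) (hb : b ≤ 1) {T : ℕ} (hT : 0 < T)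
    (hrare : (trajLaw L G (Function.update θ i ψ) init).real {ω | plays i T ω < η * T} ≤
      C * (T : ℝ) ^ (b - 1)) :
    (1 - b) * Real.log T * (1 - (∫ ω, (plays i T ω : ℝ) ∂(trajLaw L G θ init)) / (η * T)) ≤
      (G.I (θ i) ψ).toReal * ∫ ω, (plays i T ω : ℝ) ∂(trajLaw L G θ init) + Real.log (1 + C) := by
  have hT' : (0 : ℝ) < T := Nat.cast_pos.2 hT
  have hexp : Real.exp ((1 - b) * Real.log T) * (C * (T : ℝ) ^ (b - 1)) = C := by
    rw [mul_comm (1 - b), ← Real.rpow_def_of_pos hT', mul_left_comm, ← Real.rpow_add hT',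
      sub_add_sub_cancel', sub_self, Real.rpow_zero, mul_one]
  refine (mul_le_mul_of_nonneg_left (one_sub_div_le_measureReal_lt
    (ae_of_all _ fun ω => Nat.cast_nonneg _) (integrable_plays L G θ init i T)
    (mul_pos hη hT')) (mul_nonneg (sub_nonneg.2 hb) (Real.log_natCast_nonneg T))).trans ?_
  refine (mul_measureReal_plays_lt_le L G θ init hI T _ (η * T)).trans ?_
  gcongr
  exact (mul_le_mul_of_nonneg_left hrare (Real.exp_pos _).le).trans_eq hexp

lemma inv_le_liminf_integral_plays_div_log [Fintype S] [DecidableEq S] [MeasurableSingletonClass S]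
    [Finite A] [MeasurableSingletonClass A] (hD : D.IsIrreducible) (hA1 : G.A1)
    {θ : Fin M → Ψ} {i : Fin M} {ψ : Ψ}
    (hlt : optReward D G θ < optReward D G (Function.update θ i ψ))
    (hL : ∀ b : ℝ, 0 < b → (fun T : ℕ => regret L G (Function.update θ i ψ) init T) =o[atTop]
      fun T : ℕ => (T : ℝ) ^ b) :
    (G.I (θ i) ψ)⁻¹ ≤ liminf (fun T : ℕ => ENNReal.ofReal
      (∫ ω, (plays i T ω : ℝ) / Real.log T ∂(trajLaw L G θ init))) atTop := by
  refine le_of_forall_lt_imp_le_of_dense fun y hy => le_liminf_of_le (by isBoundedDefault) ?_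
  lift y to NNReal using hy.ne_top
  have hI : G.I (θ i) ψ ≠ ∞ := ENNReal.inv_ne_zero.1 (bot_le.trans_lt hy).ne'
  have hyI : y * (G.I (θ i) ψ).toReal < 1 := by
    rw [← one_div, ENNReal.lt_div_iff_mul_lt (.inr ENNReal.coe_ne_top) (.inl hI)] at hy
    simpa using (ENNReal.toReal_lt_toReal hy.ne_top ENNReal.one_ne_top).2 hy
  obtain ⟨b, hb0, hb⟩ := exists_between (sub_pos.2 hyI)
  obtain ⟨η, hη, C, hrare⟩ := exists_measureReal_plays_lt_le_rpow L (Function.update θ i ψ) init hD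
    hA1 (fun k hk => (Function.update_of_ne hk ψ θ).symm) hlt hb0.le (hL b hb0).isBigO
  have hb1 : b < 1 := hb.trans_le
    (sub_le_self 1 (mul_nonneg y.coe_nonneg ENNReal.toReal_nonneg))
  have hbound := eventually_le_div_log ENNReal.toReal_nonneg hη (sub_pos.2 hb1)
    (lt_sub_comm.1 hb) ((hrare.and (eventually_gt_atTop 0)).mono fun T hT =>
      log_mul_one_sub_le L init hI hη hb1.le hT.2 hT.1)
  filter_upwards [hbound] with T hT
  rw [integral_div, ← ENNReal.ofReal_coe_nnreal]
  exact ENNReal.ofReal_le_ofReal hT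

end LowerBound

/-! ### Improving a suboptimal channel -/

section Improvement

variable {S A Ψ 𝒳 : Type*} [MeasurableSpace 𝒳] {M : ℕ} {G : GainModel Ψ A 𝒳}

lemma GainModel.exists_mean_lt_and_lt_inv_I (hA2 : G.A2) (hA3 : G.A3) (hA4 : G.A4) {a : A}
    {θ θ' : Ψ} (hlt : G.mean a θ < G.mean a θ') {y : ℝ≥0∞} (hy : y < (G.I θ θ')⁻¹) :
    ∃ ψ, G.mean a θ' < G.mean a ψ ∧ y < (G.I θ ψ)⁻¹ := by
  obtain ⟨K, hIK, hKy⟩ := exists_between (ENNReal.lt_inv_iff_lt_inv.1 hy)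
  have hgap : 0 < K.toReal - (G.I θ θ').toReal :=
    sub_pos.2 ((ENNReal.toReal_lt_toReal hIK.ne_top hKy.ne_top).2 hIK)
  obtain ⟨δ, hδ, hclose⟩ := hA4 _ hgap a θ θ' hlt
  obtain ⟨ψ, hψ, hψδ⟩ := hA2 θ' a δ hδ
  have hfinite : G.I θ ψ ≠ ∞ := (hA3 θ ψ ⟨a, hlt.trans hψ⟩).2.ne
  have hIψ : (G.I θ ψ).toReal < K.toReal := by
    linarith [neg_lt_of_abs_lt (hclose ψ hψ hψδ)]
  exact ⟨ψ, hψ, ENNReal.lt_inv_iff_lt_inv.2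
    (((ENNReal.toReal_lt_toReal hfinite hKy.ne_top).1 hIψ).trans hKy)⟩

variable [Fintype S] [DecidableEq S] [MeasurableSpace S] [MeasurableSingletonClass S] [Nonempty S]
  [Finite A] [MeasurableSpace A] {D : MDP S A}

lemma optimalChannels_nonempty [Nonempty (Fin M)] (hD : D.IsIrreducible) (G : GainModel Ψ A 𝒳)
    (θ : Fin M → Ψ) : (optimalChannels D G θ).Nonempty := by
  obtain ⟨β, hβ⟩ := exists_avgReward_eq_optReward G θ D
  obtain ⟨s⟩ := ‹Nonempty S›
  obtain ⟨j, hj⟩ := exists_mean_eq_bestMean G θ (β s : A)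
  exact ⟨j, β, fun β' => (avgReward_le_optReward G θ D β').trans_eq hβ.symm, s,
    MDP.stationaryDist_pos hD β s, fun k => (mean_le_bestMean G θ _ k).trans_eq hj.symm⟩

lemma optReward_lt_optReward_update (hD : D.IsIrreducible) {θ : Fin M → Ψ} {i : Fin M}
    (hi : i ∉ optimalChannels D G θ) {β : D.Policy}
    (hβ : ∀ β' : D.Policy, avgReward D G θ β' ≤ avgReward D G θ β) {s : S} {ψ : Ψ}
    (hψ : bestMean G θ (β s) < G.mean (β s) ψ) :
    optReward D G θ < optReward D G (Function.update θ i ψ) := by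
  have : Nonempty (Fin M) := ⟨i⟩
  have hpos := MDP.stationaryDist_pos hD β
  have hle (x : S) : bestMean G θ (β x) ≤ bestMean G (Function.update θ i ψ) (β x) := by
    obtain ⟨k, hk⟩ := exists_mean_eq_bestMean G θ (β x : A)
    have hki : k ≠ i := by
      rintro rfl
      exact hi ⟨β, hβ, x, hpos x, fun l => (mean_le_bestMean G θ _ l).trans_eq hk.symm⟩
    rw [← hk, ← Function.update_of_ne hki ψ θ]
    exact mean_le_bestMean G _ _ k
  have hlt : bestMean G θ (β s) < bestMean G (Function.update θ i ψ) (β s) :=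
    hψ.trans_le (by simpa only [Function.update_self] using
      mean_le_bestMean G (Function.update θ i ψ) (β s) i)
  calc optReward D G θ ≤ avgReward D G θ β := ciSup_le hβ
    _ < avgReward D G (Function.update θ i ψ) β :=
      Finset.sum_lt_sum (fun x _ => mul_le_mul_of_nonneg_left (hle x) (hpos x).le)
        ⟨s, Finset.mem_univ s, mul_lt_mul_of_pos_left hlt (hpos s)⟩
    _ ≤ optReward D G (Function.update θ i ψ) := avgReward_le_optReward G _ D β

lemma exists_optReward_lt_update_and_lt_inv_I (hD : D.IsIrreducible) (hA2 : G.A2) (hA3 : G.A3)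
    (hA4 : G.A4) {θ : Fin M → Ψ} {i j : Fin M} (hi : i ∉ optimalChannels D G θ)
    (hj : j ∈ optimalChannels D G θ) {y : ℝ≥0∞} (hy : y < (G.I (θ i) (θ j))⁻¹) :
    ∃ ψ, optReward D G θ < optReward D G (Function.update θ i ψ) ∧ y < (G.I (θ i) ψ)⁻¹ := by
  have : Nonempty (Fin M) := ⟨i⟩
  obtain ⟨β, hβ, s, hs, hjs⟩ := hj
  have hij : G.mean (β s) (θ i) < G.mean (β s) (θ j) :=
    lt_of_le_of_ne (hjs i) fun heq => hi ⟨β, hβ, s, hs, fun k => (hjs k).trans_eq heq.symm⟩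
  obtain ⟨ψ, hψ, hyψ⟩ := G.exists_mean_lt_and_lt_inv_I hA2 hA3 hA4 hij hy
  exact ⟨ψ, optReward_lt_optReward_update hD hi hβ ((ciSup_le hjs).trans_lt hψ), hyψ⟩

end Improvement

end

end MultiChannel

theorem mainTheorem6_general {S A Ψ 𝒳 : Type*}
    [Fintype S] [DecidableEq S] [MeasurableSpace S] [MeasurableSingletonClass S]
    [Finite A] [MeasurableSpace A] [MeasurableSingletonClass A]
    [MeasurableSpace 𝒳] {M : ℕ}
    (D : MultiChannel.MDP S A) (hD : D.IsIrreducible)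
    (G : MultiChannel.GainModel Ψ A 𝒳)
    (hA1 : G.A1) (hA2 : G.A2) (hA3 : G.A3) (hA4 : G.A4)
    (init : Measure S) [IsProbabilityMeasure init]
    (L : MultiChannel.AllocationRule D 𝒳 M)
    (hL : ∀ (θ : Fin M → Ψ) (b : ℝ), 0 < b →
      (fun T : ℕ => MultiChannel.regret L G θ init T) =o[atTop] fun T : ℕ => (T : ℝ) ^ b)
    (θ : Fin M → Ψ) :
    (MultiChannel.optimalChannels D G θ).Nonempty ∧
    ∀ i : Fin M, i ∉ MultiChannel.optimalChannels D G θ →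
      (⨆ j ∈ MultiChannel.optimalChannels D G θ, (G.I (θ i) (θ j))⁻¹) ≤
        liminf (fun T : ℕ => ENNReal.ofReal
          (∫ ω, (MultiChannel.plays i T ω : ℝ) / Real.log T
            ∂(MultiChannel.trajLaw L G θ init))) atTop := by
  have hS : Nonempty S := nonempty_of_isProbabilityMeasure init
  have hM : Nonempty (Fin M) :=
    (nonempty_of_isProbabilityMeasure (L.choose 0 (Fin.elim0, hS.some))).map Prod.snd
  refine ⟨MultiChannel.optimalChannels_nonempty hD G θ, fun i hi => iSup₂_le fun j hj =>
    le_of_forall_lt_imp_le_of_dense fun y hy => ?_⟩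
  obtain ⟨ψ, hlt, hyψ⟩ :=
    MultiChannel.exists_optReward_lt_update_and_lt_inv_I hD hA2 hA3 hA4 hi hj hy
  exact hyψ.le.trans (MultiChannel.inv_le_liminf_integral_plays_div_log L init hD hA1 hlt
    (hL (Function.update θ i ψ)))

theorem mainTheorem6 {S A Ψ 𝒳 : Type*}
    [Fintype S] [DecidableEq S] [MeasurableSpace S] [MeasurableSingletonClass S]
    [Fintype A] [MeasurableSpace A] [MeasurableSingletonClass A]
    [MeasurableSpace 𝒳] {M : ℕ}
    (D : MultiChannel.MDP S A) (hD : D.IsErgodic)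
    (G : MultiChannel.GainModel Ψ A 𝒳)
    (hA1 : G.A1) (hA2 : G.A2) (hA3 : G.A3) (hA4 : G.A4)
    (init : Measure S) [IsProbabilityMeasure init]
    (L : MultiChannel.AllocationRule D 𝒳 M)
    (hL : ∀ (θ : Fin M → Ψ) (b : ℝ), 0 < b →
      (fun T : ℕ => MultiChannel.regret L G θ init T) =o[atTop] fun T : ℕ => (T : ℝ) ^ b)
    (θ : Fin M → Ψ) :
    (MultiChannel.optimalChannels D G θ).Nonempty ∧
    ∀ i : Fin M, i ∉ MultiChannel.optimalChannels D G θ →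
      (⨆ j ∈ MultiChannel.optimalChannels D G θ, (G.I (θ i) (θ j))⁻¹) ≤
        liminf (fun T : ℕ => ENNReal.ofReal
          (∫ ω, (MultiChannel.plays i T ω : ℝ) / Real.log T
            ∂(MultiChannel.trajLaw L G θ init))) atTop :=
  mainTheorem6_general D (fun β => (hD β).1) G hA1 hA2 hA3 hA4 init L hL θ
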